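/- Let $L = 10^6$. Consider the oriented square lattice with vertex set $\mathbb{V} = \{(i,j)\in\mathbb{Z}^2 : i+j \text{ is even}\}$ and oriented edges $\mathbb{E} = \{((i_1,j_1),(i_2,j_2))\in\mathbb{V}^2 : i_2 = i_1+1,\ |j_2-j_1| = 1\}$. Let $\rho,p\in[0,1]$ and let $\xi = (\xi_i)_{i\in\mathbb{Z}}$ be a sequence of i.i.d. $\mathrm{Geo}(1-\rho)$ random variables, that is, with values in $\{0,1,2,\dots\}$ and $\mathbb{P}(\xi_i = n) = (1-\rho)\rho^n$ for every $n\ge 0$. Given $\xi$, let $P^\xi_p$ be the law of the bond percolation on $(\mathbb{V},\mathbb{E})$ in which the edges are open or closed independently of each other, and each edge $((i,j),(i+1,j\pm1))$ is open with probability $p^{\xi_i+1}$. If $\rho\le L^{-16}$ and $p\ge (1-L^{-10})^{1/4}$, then for almost every environment $\xi$, $$P^\xi_p\big[(0,0)\text{ is connected to infinity}\big] > 0,$$ where $(0,0)$ is connected to infinity if infinitely many vertices can be reached from $(0,0)$ along oriented paths of open edges. -/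

import Mathlib

namespace OrientedPercolation

open MeasureTheory ProbabilityTheory

/-- The vertices of the oriented (rotated) square lattice: the points of `ℤ²` whose coordinates
have an even sum. -/
def latticeVertices : Set (ℤ × ℤ) := {v | Even (v.1 + v.2)}

/-- The oriented edges `((i, j), (i + 1, j'))` with `|j' - j| = 1` between lattice vertices. -/
def latticeEdges : Set ((ℤ × ℤ) × (ℤ × ℤ)) :=
  {e | e.1 ∈ latticeVertices ∧ e.2 ∈ latticeVertices ∧
    e.2.1 = e.1.1 + 1 ∧ |e.2.2 - e.1.2| = 1}

/-- A bond configuration; `true` means open and `false` means closed. -/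
abbrev Configuration : Type := latticeEdges → Bool

/-- The quenched law in the environment `ξ`: the edges are independent, and an edge
leaving column `i` is open with probability `p ^ (ξ i + 1)`. -/
noncomputable def quenchedLaw (ξ : ℤ → ℕ) (p : unitInterval) : Measure Configuration :=
  Measure.infinitePi fun e : latticeEdges ↦
    bernoulliMeasure true false (p ^ (ξ e.1.1.1 + 1))

/-- `v → w` is an open oriented edge of the lattice. -/
def OpenEdge (ω : Configuration) (v w : ℤ × ℤ) : Prop :=
  ∃ h : (v, w) ∈ latticeEdges, ω ⟨(v, w), h⟩ = true

/-- The vertices that can be reached from `v` by a finite oriented path of open edges. -/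
def openCluster (ω : Configuration) (v : ℤ × ℤ) : Set (ℤ × ℤ) :=
  {w | Relation.ReflTransGen (OpenEdge ω) v w}

/-- The event that `v` is connected to infinity: infinitely many vertices can be reached from
`v` along open oriented paths. -/
def connectedToInfinity (v : ℤ × ℤ) : Set Configuration :=
  {ω | (openCluster ω v).Infinite}

end OrientedPercolation

/-! The proof is a multiscale renormalization. Call a point open if both edges leaving it are open.
Open points are independent and their probability depends only on the column, so each column carries
a label: with label `0` a point is closed with probability at most `failBound k`, and with label `l
> 0` it is open with probability at least `2⁻ˡ`.

At level `k`, cut the sequence of labels in the middle of its successive disjoint runs of `2 *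
runLength k` zeros, and group the lanes into overlapping blocks. Inside a block, the good columns on
the left spread the reached set over all lanes. The defects in the middle are crossed along many
disjoint zigzags, each surviving with probability at least `2 ^ (-σ)` for the total cost `σ`. The
good columns on the right spread a single survivor again. Having many lanes multiplies the chance of
crossing, which lowers the cost by `gain k`. If `σ ≤ gain k`, the block fails with probability at
most `failBound (k + 1)`: one closed point in each good stretch is harmless, so these stretches
contribute only to second order. Otherwise it is open with probability at least `2 ^ (-(σ - gain
k))`. Hence blocks are again independent sites with labelled columns (`siteBound_le_blockEvent`).

The new labels are again i.i.d., because the sequence after a run of zeros is independent of what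
precedes it (`map_nextLabels`). A supermartingale for the cost shows that their exponential moments
decay geometrically (`exists_levelLaw`). By Borel–Cantelli, almost surely the first columns of all
high levels are good (`ae_levels`).

In such an environment the origin survives if a finite cone of points is open and, at every high
level, the points of the first good columns around the origin are open. The cone has positive
probability, the second event has probability at least `1/2`, and they are independent
(`exists_survival_event`). -/

namespace OrientedPercolation

/-! ### Deterministic spreading inside a block -/

/-- All the lanes of `[α, β]` with the parity of `n` belong to `S`. -/
def FullOn (S : ℤ → Prop) (n : ℕ) (α β : ℤ) : Prop :=
  ∀ y, α ≤ y → y ≤ β → Even ((n : ℤ) + y) → S y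

/-- The time-dependent set `S` is transmitted by the open sites of the block `X`: the times of
`[a, b)` and the lanes strictly between `(X - 1) * W` and `(X + 1) * W`. -/
def Transmits (η : ℕ × ℤ → Prop) (W X : ℤ) (a b : ℕ) (S : ℕ → ℤ → Prop) : Prop :=
  ∀ n y, a ≤ n → n < b → (X - 1) * W + 1 ≤ y → y ≤ (X + 1) * W - 1 → Even ((n : ℤ) + y) →
    S n y → η (n, y) → S (n + 1) (y + 1) ∧ S (n + 1) (y - 1)

/-- A block is open if every transmitted set that fills one of the two windows around the centre
of the block at the initial time fills the adjacent windows of the two neighbours at the end. -/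
def BlockOpen (η : ℕ × ℤ → Prop) (W X : ℤ) (a b : ℕ) : Prop :=
  ∀ S : ℕ → ℤ → Prop, Transmits η W X a b S →
    (FullOn (S a) a (X * W - 6) (X * W - 2) ∨ FullOn (S a) a (X * W + 2) (X * W + 6)) →
    FullOn (S b) b ((X + 1) * W - 6) ((X + 1) * W - 2) ∧
      FullOn (S b) b ((X - 1) * W + 2) ((X - 1) * W + 6)

lemma FullOn.mono {S : ℤ → Prop} {n : ℕ} {α β α' β' : ℤ} (h : FullOn S n α β)
    (hα : α ≤ α') (hβ : β' ≤ β) : FullOn S n α' β' :=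
  fun y h1 h2 h3 ↦ h y (by omega) (by omega) h3

section Spread

variable {η : ℕ × ℤ → Prop} {W X : ℤ} {a b : ℕ} {S : ℕ → ℤ → Prop}

/-- Each new lane needs only one parent in `[α, β]`. The condition `hne` excludes an interval that
contains no lane of the right parity, for which fullness would be vacuous. -/
lemma Transmits.step_open (hS : Transmits η W X a b S) {n : ℕ} {α β : ℤ} (ha : a ≤ n) (hb : n < b)
    (hα : (X - 1) * W + 1 ≤ α) (hβ : β ≤ (X + 1) * W - 1)
    (hne : α < β ∨ (α = β ∧ Even ((n : ℤ) + α)))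
    (hopen : ∀ y, α ≤ y → y ≤ β → Even ((n : ℤ) + y) → η (n, y))
    (h : FullOn (S n) n α β) : FullOn (S (n + 1)) (n + 1) (α - 1) (β + 1) := by
  intro y h1 h2 h3
  have key : (α ≤ y - 1 ∧ y - 1 ≤ β) ∨ (α ≤ y + 1 ∧ y + 1 ≤ β) := by
    rcases hne with hne | ⟨rfl, hne⟩
    · omega
    · have : y ≠ α := by
        rintro rfl
        push_cast at h3
        rw [Int.even_iff] at *
        omega
      omega
  have hp1 : Even ((n : ℤ) + (y - 1)) := by
    push_cast at h3; rw [Int.even_iff] at *; omega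
  have hp2 : Even ((n : ℤ) + (y + 1)) := by
    push_cast at h3; rw [Int.even_iff] at *; omega
  rcases key with ⟨k1, k2⟩ | ⟨k1, k2⟩
  · have := (hS n (y - 1) ha hb (by omega) (by omega) hp1 (h _ k1 k2 hp1) (hopen _ k1 k2 hp1)).1
    simpa using this
  · have := (hS n (y + 1) ha hb (by omega) (by omega) hp2 (h _ k1 k2 hp2) (hopen _ k1 k2 hp2)).2
    simpa using this

/-- A lane of the shrunken interval has both its parents in `[α, β]`, and at most one of them is
`z`. -/
lemma Transmits.step_closed (hS : Transmits η W X a b S) {n : ℕ} {α β z : ℤ} (ha : a ≤ n)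
    (hb : n < b) (hα : (X - 1) * W + 1 ≤ α) (hβ : β ≤ (X + 1) * W - 1)
    (hopen : ∀ y, α ≤ y → y ≤ β → y ≠ z → Even ((n : ℤ) + y) → η (n, y))
    (h : FullOn (S n) n α β) : FullOn (S (n + 1)) (n + 1) (α + 1) (β - 1) := by
  intro y h1 h2 h3
  have hp1 : Even ((n : ℤ) + (y - 1)) := by
    push_cast at h3; rw [Int.even_iff] at *; omega
  have hp2 : Even ((n : ℤ) + (y + 1)) := by
    push_cast at h3; rw [Int.even_iff] at *; omega
  by_cases hz : y - 1 = z
  · have := (hS n (y + 1) ha hb (by omega) (by omega) hp2 (h _ (by omega) (by omega) hp2)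
      (hopen _ (by omega) (by omega) (by omega) hp2)).2
    simpa using this
  · have := (hS n (y - 1) ha hb (by omega) (by omega) hp1 (h _ (by omega) (by omega) hp1)
      (hopen _ (by omega) (by omega) hz hp1)).1
    simpa using this

lemma Transmits.spread_open (hS : Transmits η W X a b S) {n : ℕ} {α β : ℤ} (ha : a ≤ n)
    (hα : (X - 1) * W + 1 ≤ α) (hβ : β ≤ (X + 1) * W - 1)
    (hne : α < β ∨ (α = β ∧ Even ((n : ℤ) + α))) (hW : 4 ≤ W) (t : ℕ) (hb : n + t ≤ b)
    (hopen : ∀ i y, n ≤ i → i < n + t → (X - 1) * W + 1 ≤ y → y ≤ (X + 1) * W - 1 →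
      Even ((i : ℤ) + y) → η (i, y))
    (h : FullOn (S n) n α β) :
    FullOn (S (n + t)) (n + t) (max ((X - 1) * W + 1) (α - t)) (min ((X + 1) * W - 1) (β + t)) := by
  have hexp1 : (X - 1) * W = X * W - W := by ring
  have hexp2 : (X + 1) * W = X * W + W := by ring
  induction t with
  | zero => exact h.mono (by simp) (by simp)
  | succ t ih =>
    have ih' := ih (by omega) (fun i y h1 h2 ↦ hopen i y h1 (by omega))
    have hne' : max ((X - 1) * W + 1) (α - t) < min ((X + 1) * W - 1) (β + t) ∨
        (max ((X - 1) * W + 1) (α - t) = min ((X + 1) * W - 1) (β + t) ∧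
          Even (((n + t : ℕ) : ℤ) + max ((X - 1) * W + 1) (α - t))) := by
      rcases hne with hne | ⟨rfl, hne⟩
      · left; omega
      · rcases Nat.eq_zero_or_pos t with rfl | ht
        · right
          have e1 : max ((X - 1) * W + 1) (α - (0 : ℕ)) = α := by simp; omega
          have e2 : min ((X + 1) * W - 1) (α + (0 : ℕ)) = α := by simp; omega
          rw [e1, e2]; simpa using hne
        · left; omega
    have := hS.step_open (n := n + t) (by omega) (by omega) (le_max_left _ _) (min_le_left _ _) hne'
      (fun y h1 h2 ↦ hopen _ y (by omega) (by omega) (le_trans (le_max_left _ _) h1)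
        (le_trans h2 (min_le_left _ _))) ih'
    exact this.mono (by push_cast; omega) (by push_cast; omega)

lemma Transmits.spread_fill (hS : Transmits η W X a b S) {n : ℕ} {α β : ℤ} (ha : a ≤ n)
    (hα : (X - 1) * W + 1 ≤ α) (hβ : β ≤ (X + 1) * W - 1)
    (hne : α < β ∨ (α = β ∧ Even ((n : ℤ) + α))) (hW : 4 ≤ W) (t : ℕ) (hb : n + t ≤ b)
    (ht : 2 * W ≤ t)
    (hopen : ∀ i y, n ≤ i → i < n + t → (X - 1) * W + 1 ≤ y → y ≤ (X + 1) * W - 1 →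
      Even ((i : ℤ) + y) → η (i, y))
    (h : FullOn (S n) n α β) :
    FullOn (S (n + t)) (n + t) ((X - 1) * W + 1) ((X + 1) * W - 1) := by
  have hexp1 : (X - 1) * W = X * W - W := by ring
  have hexp2 : (X + 1) * W = X * W + W := by ring
  exact (hS.spread_open ha hα hβ hne hW t hb hopen h).mono (by omega) (by omega)

/-- A single closed site does not prevent a set from filling the block. -/
lemma Transmits.spread_fill_of_one_closed (hS : Transmits η W X a b S) {n : ℕ} {α β : ℤ}
    (ha : a ≤ n) (hα : (X - 1) * W + 3 ≤ α) (hβ : β ≤ (X + 1) * W - 3) (q : ℕ × ℤ)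
    (hne : α + 4 ≤ β ∨ (α = β ∧ Even ((n : ℤ) + α) ∧ q ≠ (n, α))) (hW : 10 ≤ W) (t : ℕ)
    (hb : n + t ≤ b) (ht : 2 * W + 4 ≤ t)
    (hopen : ∀ i y, n ≤ i → i < n + t → (X - 1) * W + 1 ≤ y → y ≤ (X + 1) * W - 1 →
      Even ((i : ℤ) + y) → q ≠ (i, y) → η (i, y))
    (h : FullOn (S n) n α β) :
    FullOn (S (n + t)) (n + t) ((X - 1) * W + 2) ((X + 1) * W - 2) := by
  have hexp1 : (X - 1) * W = X * W - W := by ring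
  have hexp2 : (X + 1) * W = X * W + W := by ring
  obtain ⟨n₀, z⟩ := q
  have hne0 : α < β ∨ (α = β ∧ Even ((n : ℤ) + α)) := by
    rcases hne with h | ⟨h1, h2, -⟩
    · left; omega
    · exact Or.inr ⟨h1, h2⟩
  by_cases hn₀ : n ≤ n₀ ∧ n₀ < n + t
  swap
  · refine (hS.spread_fill ha (by omega) (by omega) hne0 (by omega) t hb (by omega)
      (fun i y h1 h2 h3 h4 h5 ↦ hopen i y h1 h2 h3 h4 h5 ?_) h).mono (by omega) (by omega)
    intro he
    rw [Prod.mk.injEq] at he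
    omega
  obtain ⟨d, rfl⟩ := Nat.exists_eq_add_of_le hn₀.1
  obtain ⟨e, he⟩ : ∃ e, t = d + 1 + e := Nat.exists_eq_add_of_le (by omega)
  subst he
  have after : ∀ α' β' : ℤ, (X - 1) * W + 1 ≤ α' → β' ≤ (X + 1) * W - 1 →
      (α' < β' ∨ (α' = β' ∧ Even (((n + d + 1 : ℕ) : ℤ) + α'))) →
      FullOn (S (n + d + 1)) (n + d + 1) α' β' →
      FullOn (S (n + (d + 1 + e))) (n + (d + 1 + e)) (max ((X - 1) * W + 1) (α' - e))
        (min ((X + 1) * W - 1) (β' + e)) := by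
    intro α' β' h1 h2 h3 h4
    have := hS.spread_open (n := n + d + 1) (by omega) h1 h2 h3 (by omega) e (by omega)
      (fun i y h1 h2 h3 h4 h5 ↦ hopen i y (by omega) (by omega) h3 h4 h5
        (by rw [Ne, Prod.mk.injEq]; omega)) h4
    rwa [show n + d + 1 + e = n + (d + 1 + e) by omega] at this
  have before := hS.spread_open ha (by omega) (by omega) hne0 (by omega) d (by omega)
    (fun i y h1 h2 h3 h4 h5 ↦ hopen i y h1 (by omega) h3 h4 h5
      (by rw [Ne, Prod.mk.injEq]; omega)) h
  have closed := hS.step_closed (n := n + d) (z := z) (by omega) (by omega) (le_max_left _ _)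
    (min_le_left _ _) (fun y h1 h2 h3 h4 ↦ hopen (n + d) y (by omega) (by omega)
      (le_trans (le_max_left _ _) h1) (le_trans h2 (min_le_left _ _)) h4
      (by rw [Ne, Prod.mk.injEq]; omega)) before
  -- Shrinking at the time `n + d` of the closed site leaves a nonempty interval. A width of at
  -- least `4` is enough at any time. From a single lane, `d = 0` is harmless because the closed
  -- site lies elsewhere, `d = 1` brings three positions back to the starting lane, whose parity is
  -- right, and `d ≥ 2` leaves an interval of positive length.
  rcases hne with hne | ⟨rfl, hev, hq⟩
  · exact (after _ _ (by omega) (by omega) (by left; omega) closed).mono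
      (by push_cast at *; omega) (by push_cast at *; omega)
  · rcases Nat.eq_zero_or_pos d with rfl | hd
    · have hz : z ≠ α := by rintro rfl; exact hq rfl
      have h1 : FullOn (S (n + 0 + 1)) (n + 0 + 1) (α - 1) (α + 1) :=
        hS.step_open (n := n) ha (by omega) (by omega) (by omega) (Or.inr ⟨rfl, hev⟩)
          (fun y h1 h2 h3 ↦ hopen n y le_rfl (by omega) (by omega) (by omega) h3
            (by rw [Ne, Prod.mk.injEq]; omega)) h
      exact (after _ _ (by omega) (by omega) (by left; omega) h1).mono
        (by push_cast at *; omega) (by push_cast at *; omega)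
    · refine (after _ _ (by omega) (by omega) ?_ closed).mono
        (by push_cast at *; omega) (by push_cast at *; omega)
      by_cases hd1 : d = 1
      · right
        subst hd1
        have e1 : max ((X - 1) * W + 1) (α - (1 : ℕ)) = α - 1 := by push_cast; omega
        have e2 : min ((X + 1) * W - 1) (α + (1 : ℕ)) = α + 1 := by push_cast; omega
        rw [e1, e2]
        refine ⟨by ring, ?_⟩
        push_cast
        rw [Int.even_iff] at *
        omega
      · left; omega

/-- A zigzag of open sites keeps a lane alive. -/
lemma Transmits.zigzag (hS : Transmits η W X a b S) {n : ℕ} {y : ℤ} (ha : a ≤ n)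
    (hα : (X - 1) * W + 1 ≤ y) (hβ : y ≤ (X + 1) * W - 2) (hy : Even ((n : ℤ) + y)) (t : ℕ)
    (hb : n + t ≤ b) (hopen : ∀ i < t, η (n + i, y + (i % 2 : ℕ))) (h : S n y) :
    S (n + t) (y + (t % 2 : ℕ)) := by
  induction t with
  | zero => simpa using h
  | succ t ih =>
    have ih' := ih (by omega) (fun i hi ↦ hopen i (by omega))
    have hp : Even (((n + t : ℕ) : ℤ) + (y + (t % 2 : ℕ))) := by
      push_cast; rw [Int.even_iff] at *; omega
    have := hS (n + t) _ (by omega) (by omega) (by omega) (by omega) hp ih' (hopen t (by omega))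
    rcases Nat.mod_two_eq_zero_or_one t with h0 | h0
    · have h1 : (t + 1) % 2 = 1 := by omega
      rw [h0] at this; rw [h1]
      simpa [add_assoc] using this.1
    · have h1 : (t + 1) % 2 = 0 := by omega
      rw [h0] at this; rw [h1]
      simpa [add_assoc] using this.2

end Spread

/-- The open or closed state of a block only depends on the sites of the block. -/
lemma BlockOpen.congr {η η' : ℕ × ℤ → Prop} {W X : ℤ} {a b : ℕ}
    (h : ∀ n y, a ≤ n → n < b → (X - 1) * W + 1 ≤ y → y ≤ (X + 1) * W - 1 →
      Even ((n : ℤ) + y) → (η (n, y) ↔ η' (n, y))) :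
    BlockOpen η W X a b ↔ BlockOpen η' W X a b := by
  refine forall_congr' fun S ↦ ?_
  have : Transmits η W X a b S ↔ Transmits η' W X a b S := by
    unfold Transmits
    refine forall₂_congr fun n y ↦ forall₅_congr fun h1 h2 h3 h4 h5 ↦ ?_
    rw [h n y h1 h2 h3 h4 h5]
  rw [this]

end OrientedPercolation

/-! ### Deterministic conditions for a block to be open -/

namespace OrientedPercolation

/-- The block is filled, crossed along a zigzag, and filled again from the surviving lane; each
filling tolerates one closed site. A second zigzag is needed because `q'` may be the very site on
which the first one ends. -/
lemma blockOpen_of_two_trials {η : ℕ × ℤ → Prop} {W X : ℤ} {a R t : ℕ} (hW : 10 ≤ W)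
    (hR : 2 * W + 4 ≤ R) (q q' : ℕ × ℤ)
    (h₁ : ∀ i y, a ≤ i → i < a + R → (X - 1) * W + 1 ≤ y → y ≤ (X + 1) * W - 1 →
      Even ((i : ℤ) + y) → q ≠ (i, y) → η (i, y))
    (h₃ : ∀ i y, a + R + t ≤ i → i < a + R + t + R → (X - 1) * W + 1 ≤ y → y ≤ (X + 1) * W - 1 →
      Even ((i : ℤ) + y) → q' ≠ (i, y) → η (i, y))
    (y y' : ℤ) (hyy' : y ≠ y')
    (hy : (X - 1) * W + 3 ≤ y ∧ y ≤ (X + 1) * W - 4 ∧ Even (((a + R : ℕ) : ℤ) + y))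
    (hy' : (X - 1) * W + 3 ≤ y' ∧ y' ≤ (X + 1) * W - 4 ∧ Even (((a + R : ℕ) : ℤ) + y'))
    (h₂ : ∀ i < t, η (a + R + i, y + (i % 2 : ℕ))) (h₂' : ∀ i < t, η (a + R + i, y' + (i % 2 : ℕ))) :
    BlockOpen η W X a (a + R + t + R) := by
  intro S hS hstart
  have hexp1 : (X - 1) * W = X * W - W := by ring
  have hexp2 : (X + 1) * W = X * W + W := by ring
  have fill₁ : FullOn (S (a + R)) (a + R) ((X - 1) * W + 2) ((X + 1) * W - 2) := by
    rcases hstart with h | h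
    · exact hS.spread_fill_of_one_closed le_rfl (by omega) (by omega) q (by left; omega) hW R
        (by omega) hR h₁ h
    · exact hS.spread_fill_of_one_closed le_rfl (by omega) (by omega) q (by left; omega) hW R
        (by omega) hR h₁ h
  have alive : ∀ z, (X - 1) * W + 3 ≤ z ∧ z ≤ (X + 1) * W - 4 ∧ Even (((a + R : ℕ) : ℤ) + z) →
      (∀ i < t, η (a + R + i, z + (i % 2 : ℕ))) → S (a + R + t) (z + (t % 2 : ℕ)) :=
    fun z hz h ↦ hS.zigzag (by omega) (by omega) (by omega) hz.2.2 t (by omega) h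
      (fill₁ z (by omega) (by omega) hz.2.2)
  have final : ∀ z, (X - 1) * W + 3 ≤ z ∧ z ≤ (X + 1) * W - 4 ∧ Even (((a + R : ℕ) : ℤ) + z) →
      (∀ i < t, η (a + R + i, z + (i % 2 : ℕ))) → q' ≠ (a + R + t, z + (t % 2 : ℕ)) →
      FullOn (S (a + R + t + R)) (a + R + t + R) ((X - 1) * W + 2) ((X + 1) * W - 2) := by
    intro z hz h hq
    have hev : Even (((a + R + t : ℕ) : ℤ) + (z + (t % 2 : ℕ))) := by
      have := hz.2.2; push_cast at *; rw [Int.even_iff] at *; omega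
    refine hS.spread_fill_of_one_closed (α := z + (t % 2 : ℕ)) (β := z + (t % 2 : ℕ)) (by omega)
      (by omega) (by omega) q' (Or.inr ⟨rfl, hev, hq⟩) hW R (by omega) hR h₃ ?_
    intro w hw1 hw2 _
    obtain rfl : w = z + (t % 2 : ℕ) := by omega
    exact alive z hz h
  have full : FullOn (S (a + R + t + R)) (a + R + t + R) ((X - 1) * W + 2) ((X + 1) * W - 2) := by
    by_cases hq : q' = (a + R + t, y + (t % 2 : ℕ))
    · refine final y' hy' h₂' ?_
      rw [hq, Ne, Prod.mk.injEq]
      omega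
    · exact final y hy h₂ hq
  exact ⟨full.mono (by omega) (by omega), full.mono (by omega) (by omega)⟩

lemma blockOpen_of_trial {η : ℕ × ℤ → Prop} {W X : ℤ} {a R t : ℕ} (hW : 10 ≤ W)
    (hR : 2 * W + 4 ≤ R)
    (h₁ : ∀ i y, a ≤ i → i < a + R → (X - 1) * W + 1 ≤ y → y ≤ (X + 1) * W - 1 →
      Even ((i : ℤ) + y) → η (i, y))
    (h₃ : ∀ i y, a + R + t ≤ i → i < a + R + t + R → (X - 1) * W + 1 ≤ y → y ≤ (X + 1) * W - 1 →
      Even ((i : ℤ) + y) → η (i, y))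
    (y : ℤ) (hy : (X - 1) * W + 3 ≤ y ∧ y ≤ (X + 1) * W - 4 ∧ Even (((a + R : ℕ) : ℤ) + y))
    (h₂ : ∀ i < t, η (a + R + i, y + (i % 2 : ℕ))) :
    BlockOpen η W X a (a + R + t + R) := by
  intro S hS hstart
  have hexp1 : (X - 1) * W = X * W - W := by ring
  have hexp2 : (X + 1) * W = X * W + W := by ring
  have fill₁ : FullOn (S (a + R)) (a + R) ((X - 1) * W + 1) ((X + 1) * W - 1) := by
    rcases hstart with h | h
    · exact hS.spread_fill le_rfl (by omega) (by omega) (by left; omega) (by omega) R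
        (by omega) (by omega) h₁ h
    · exact hS.spread_fill le_rfl (by omega) (by omega) (by left; omega) (by omega) R
        (by omega) (by omega) h₁ h
  have alive : S (a + R + t) (y + (t % 2 : ℕ)) :=
    hS.zigzag (by omega) (by omega) (by omega) hy.2.2 t (by omega) h₂
      (fill₁ y (by omega) (by omega) hy.2.2)
  have hev : Even (((a + R + t : ℕ) : ℤ) + (y + (t % 2 : ℕ))) := by
    have := hy.2.2; push_cast at *; rw [Int.even_iff] at *; omega
  have full : FullOn (S (a + R + t + R)) (a + R + t + R) ((X - 1) * W + 1) ((X + 1) * W - 1) := by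
    refine hS.spread_fill (α := y + (t % 2 : ℕ)) (β := y + (t % 2 : ℕ)) (by omega) (by omega)
      (by omega) (Or.inr ⟨rfl, hev⟩) (by omega) R (by omega) (by omega) h₃ ?_
    intro w hw1 hw2 _
    obtain rfl : w = y + (t % 2 : ℕ) := by omega
    exact alive
  exact ⟨full.mono (by omega) (by omega), full.mono (by omega) (by omega)⟩

/-! ### Functions of disjoint groups of independent events -/

section Independence

open MeasureTheory ProbabilityTheory MeasurableSpace

variable {ι κ Ω : Type*}

/-- An event that is a function of finitely many events is measurable with respect to the
σ-algebra they generate. -/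
lemma measurableSet_of_finite_dependence (E : ι → Set Ω) (T : Finset ι) (Φ : (ι → Prop) → Prop)
    (hΦ : ∀ η η' : ι → Prop, (∀ i ∈ T, (η i ↔ η' i)) → (Φ η ↔ Φ η')) :
    MeasurableSet[⨆ i ∈ (T : Set ι), generateFrom {E i}] {ω | Φ fun i ↦ ω ∈ E i} := by
  classical
  let m : MeasurableSpace Ω := ⨆ i ∈ (T : Set ι), generateFrom {E i}
  let g : Ω → (T → Prop) := fun ω i ↦ ω ∈ E i
  have hg : Measurable g := by
    refine measurable_pi_lambda _ fun i ↦ measurableSet_setOfPred.1 ?_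
    have hle : generateFrom {E i} ≤ m := le_iSup₂_of_le (f := fun i _ ↦ generateFrom {E i}) i.1
      i.2 le_rfl
    exact hle _ (measurableSet_generateFrom rfl)
  have : {ω | Φ fun i ↦ ω ∈ E i} =
      g ⁻¹' {t | Φ fun i ↦ if h : i ∈ T then t ⟨i, h⟩ else False} := by
    ext ω
    exact hΦ _ _ fun i hi ↦ by simp [g, hi]
  rw [this]
  exact hg (MeasurableSet.of_discrete)

variable {mΩ : MeasurableSpace Ω} {μ : Measure Ω}

/-- Events that depend on disjoint groups of independent events are independent. -/
lemma iIndepSet_of_disjoint {E : ι → Set Ω} (hE : ∀ i, MeasurableSet (E i)) (h : iIndepSet E μ)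
    {S : κ → Set ι} (hS : Pairwise fun j k ↦ Disjoint (S j) (S k)) {F : κ → Set Ω}
    (hF : ∀ j, MeasurableSet[⨆ i ∈ S j, generateFrom {E i}] (F j)) : iIndepSet F μ := by
  classical
  have := h.isProbabilityMeasure
  have hle : ∀ i, generateFrom {E i} ≤ mΩ := fun i ↦ generateFrom_le (by simpa using hE i)
  have hle' : ∀ A : Set ι, (⨆ i ∈ A, generateFrom {E i}) ≤ mΩ := fun A ↦ iSup₂_le fun i _ ↦ hle i
  rw [iIndepSet_iff_meas_biInter fun j ↦ hle' _ _ (hF j)]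
  intro s
  induction s using Finset.induction_on with
  | empty => simp
  | insert a s ha ih =>
    rw [Finset.set_biInter_insert, Finset.prod_insert ha, ← ih]
    have hind := indep_iSup_of_disjoint hle ((iIndepSet_iff_iIndep _ _).1 h)
      (S := S a) (T := ⋃ j ∈ s, S j) (by
        rw [Set.disjoint_iUnion₂_right]
        intro j hj
        exact hS (by rintro rfl; exact ha hj))
    refine (Indep_iff _ _ _).1 hind _ _ (hF a) ?_
    refine Finset.measurableSet_biInter _ fun j hj ↦ ?_
    have : (⨆ i ∈ S j, generateFrom {E i}) ≤ ⨆ i ∈ ⋃ j ∈ s, S j, generateFrom {E i} :=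
      biSup_mono fun i hi ↦ Set.mem_biUnion (by exact hj) hi
    exact this _ (hF j)

lemma measurableSet_biInter_generateFrom (E : ι → Set Ω) (T : Finset ι) :
    MeasurableSet[⨆ i ∈ (T : Set ι), generateFrom {E i}] (⋂ i ∈ T, E i) := by
  convert! measurableSet_of_finite_dependence E T (fun η ↦ ∀ i ∈ T, η i)
    (fun η η' h ↦ forall₂_congr h) using 1
  ext; simp

lemma iIndepSet.compl' {E : ι → Set Ω} (hE : ∀ i, MeasurableSet (E i)) (h : iIndepSet E μ) :
    iIndepSet (fun i ↦ (E i)ᶜ) μ := by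
  refine iIndepSet_of_disjoint hE h (S := fun i ↦ {i}) (fun i j hij ↦ by simpa using hij) fun i ↦ ?_
  have hle : generateFrom {E i} ≤ ⨆ i' ∈ ({i} : Set ι), generateFrom {E i'} :=
    le_iSup₂_of_le (f := fun i _ ↦ generateFrom {E i}) i rfl le_rfl
  exact hle _ (measurableSet_generateFrom (s := {E i}) rfl).compl

/-- The probability that two of finitely many independent events fail. -/
lemma measureReal_two_fail_le [IsProbabilityMeasure μ] {E : ι → Set Ω}
    (hE : ∀ i, MeasurableSet (E i)) (h : iIndepSet E μ) (A : Finset ι) {ε : ℝ}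
    (hε : ∀ i ∈ A, 1 - ε ≤ μ.real (E i)) :
    μ.real {ω | ∃ i ∈ A, ∃ j ∈ A, i ≠ j ∧ ω ∉ E i ∧ ω ∉ E j} ≤ (A.card * ε) ^ 2 := by
  classical
  have hc : ∀ i ∈ A, μ.real (E i)ᶜ ≤ ε := fun i hi ↦ by
    rw [measureReal_compl (hE i), probReal_univ]; linarith [hε i hi]
  have hsub : {ω | ∃ i ∈ A, ∃ j ∈ A, i ≠ j ∧ ω ∉ E i ∧ ω ∉ E j} ⊆
      ⋃ q ∈ A.offDiag, ((E q.1)ᶜ ∩ (E q.2)ᶜ) := by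
    rintro ω ⟨i, hi, j, hj, hij, h1, h2⟩
    simp only [Set.mem_iUnion]
    exact ⟨(i, j), Finset.mem_offDiag.2 ⟨hi, hj, hij⟩, h1, h2⟩
  calc _ ≤ μ.real (⋃ q ∈ A.offDiag, ((E q.1)ᶜ ∩ (E q.2)ᶜ)) := measureReal_mono hsub (measure_ne_top _ _)
    _ ≤ ∑ q ∈ A.offDiag, μ.real ((E q.1)ᶜ ∩ (E q.2)ᶜ) := measureReal_biUnion_finset_le _ _
    _ ≤ ∑ q ∈ A.offDiag, ε * ε := by
        refine Finset.sum_le_sum fun q hq ↦ ?_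
        obtain ⟨h1, h2, h3⟩ := Finset.mem_offDiag.1 hq
        have := (iIndepSet.compl' hE h).meas_biInter {q.1, q.2}
        rw [Finset.prod_pair h3, Finset.set_biInter_insert, Finset.set_biInter_singleton] at this
        rw [measureReal_def, this, ENNReal.toReal_mul]
        exact mul_le_mul (hc _ h1) (hc _ h2) ENNReal.toReal_nonneg
          (le_trans measureReal_nonneg (hc _ h1))
    _ = A.offDiag.card * (ε * ε) := by rw [Finset.sum_const, nsmul_eq_mul]
    _ ≤ (A.card * A.card : ℕ) * (ε * ε) := by
        gcongr
        · exact mul_self_nonneg ε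
        · rw [Finset.offDiag_card]; exact Nat.sub_le _ _
    _ = _ := by push_cast; ring

/-- The probability that each of several trials on disjoint groups of events fails. -/
lemma measureReal_trials_fail_le [IsProbabilityMeasure μ] {E : ι → Set Ω}
    (hE : ∀ i, MeasurableSet (E i)) (h : iIndepSet E μ) (T : κ → Finset ι)
    (hT : Pairwise fun j k ↦ Disjoint (T j) (T k)) {π : ℝ}
    (hπ : ∀ j, π ≤ ∏ i ∈ T j, μ.real (E i)) (J : Finset κ) :
    μ.real (⋂ j ∈ J, (⋂ i ∈ T j, E i)ᶜ) ≤ (1 - π) ^ J.card := by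
  have hF : iIndepSet (fun j ↦ (⋂ i ∈ T j, E i)ᶜ) μ :=
    iIndepSet_of_disjoint hE h (S := fun j ↦ (T j : Set ι))
      (fun j k hjk ↦ Finset.disjoint_coe.2 (hT hjk))
      fun j ↦ (measurableSet_biInter_generateFrom E (T j)).compl
  rw [measureReal_def, hF.meas_biInter J, ENNReal.toReal_prod]
  refine (Finset.prod_le_prod (fun _ _ ↦ ENNReal.toReal_nonneg) fun j _ ↦ ?_).trans_eq
    (Finset.prod_const _)
  have hm : MeasurableSet (⋂ i ∈ T j, E i) := Finset.measurableSet_biInter _ fun i _ ↦ hE i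
  rw [← measureReal_def, measureReal_compl hm, probReal_univ, measureReal_def, h.meas_biInter,
    ENNReal.toReal_prod]
  have := hπ j
  simp only [measureReal_def] at this
  linarith

lemma measureReal_biInter_ge [IsProbabilityMeasure μ] {E : ι → Set Ω}
    (hE : ∀ i, MeasurableSet (E i)) (A : Finset ι) {ε : ℝ}
    (hε : ∀ i ∈ A, 1 - ε ≤ μ.real (E i)) : 1 - A.card * ε ≤ μ.real (⋂ i ∈ A, E i) := by
  have hm : MeasurableSet (⋂ i ∈ A, E i) := Finset.measurableSet_biInter _ fun i _ ↦ hE i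
  have h1 : μ.real (⋂ i ∈ A, E i)ᶜ ≤ A.card * ε := by
    rw [Set.compl_iInter₂]
    refine (measureReal_biUnion_finset_le _ _).trans ?_
    rw [← nsmul_eq_mul, ← Finset.sum_const]
    refine Finset.sum_le_sum fun i hi ↦ ?_
    rw [measureReal_compl (hE i), probReal_univ]; linarith [hε i hi]
  rw [measureReal_compl hm, probReal_univ] at h1
  linarith

/-- All the events of `A` occur and one of the trials succeeds. -/
lemma measureReal_trial_ge [IsProbabilityMeasure μ] {E : ι → Set Ω}
    (hE : ∀ i, MeasurableSet (E i)) (h : iIndepSet E μ) (T : κ → Finset ι)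
    (hT : Pairwise fun j k ↦ Disjoint (T j) (T k)) {π : ℝ}
    (hπ : ∀ j, π ≤ ∏ i ∈ T j, μ.real (E i)) (J : Finset κ)
    (A : Finset ι) (hA : ∀ j, Disjoint A (T j)) {ε : ℝ} (hε : ∀ i ∈ A, 1 - ε ≤ μ.real (E i))
    (hA1 : A.card * ε ≤ 1) :
    (1 - A.card * ε) * (1 - (1 - π) ^ J.card) ≤
      μ.real ((⋂ i ∈ A, E i) ∩ (⋂ j ∈ J, (⋂ i ∈ T j, E i)ᶜ)ᶜ) := by
  have hle : ∀ i, generateFrom {E i} ≤ mΩ := fun i ↦ generateFrom_le (by simpa using hE i)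
  have hind := indep_iSup_of_disjoint hle ((iIndepSet_iff_iIndep _ _).1 h)
    (S := (A : Set ι)) (T := ⋃ j ∈ J, (T j : Set ι)) (by
      rw [Set.disjoint_iUnion₂_right]
      intro j _
      exact Finset.disjoint_coe.2 (hA j))
  have hm : MeasurableSet[⨆ i ∈ ⋃ j ∈ J, (T j : Set ι), generateFrom {E i}]
      (⋂ j ∈ J, (⋂ i ∈ T j, E i)ᶜ)ᶜ := by
    refine (Finset.measurableSet_biInter _ fun j hj ↦ ?_).compl
    have : (⨆ i ∈ (T j : Set ι), generateFrom {E i}) ≤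
        ⨆ i ∈ ⋃ j ∈ J, (T j : Set ι), generateFrom {E i} :=
      biSup_mono fun i hi ↦ Set.mem_biUnion (by exact hj) hi
    exact this _ (measurableSet_biInter_generateFrom E (T j)).compl
  have hm' : MeasurableSet (⋂ j ∈ J, (⋂ i ∈ T j, E i)ᶜ) :=
    Finset.measurableSet_biInter _ fun j _ ↦ (Finset.measurableSet_biInter _ fun i _ ↦ hE i).compl
  rw [measureReal_def, (Indep_iff _ _ _).1 hind _ _ (measurableSet_biInter_generateFrom E A) hm,
    ENNReal.toReal_mul, ← measureReal_def, ← measureReal_def]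
  have h1 := measureReal_biInter_ge hE A hε
  have h2 := measureReal_trials_fail_le hE h T hT hπ J
  have h3 : 1 - (1 - π) ^ J.card ≤ μ.real (⋂ j ∈ J, (⋂ i ∈ T j, E i)ᶜ)ᶜ := by
    rw [measureReal_compl hm', probReal_univ]; linarith
  exact (mul_le_mul_of_nonneg_left h3 (by linarith)).trans
    (mul_le_mul_of_nonneg_right h1 measureReal_nonneg)

end Independence

end OrientedPercolation

/-! ### The probability that a block is open -/

namespace OrientedPercolation

open MeasureTheory ProbabilityTheory MeasurableSpace

/-- The sites of the renormalized lattices. -/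
abbrev Site : Type := {p : ℕ × ℤ // Even ((p.1 : ℤ) + p.2)}

/-- The sites with time in `[a, b)` and lane in the region of the block `X`. -/
noncomputable def regionSites (W X : ℤ) (a b : ℕ) : Finset Site :=
  (Finset.Ico a b ×ˢ Finset.Icc ((X - 1) * W + 1) ((X + 1) * W - 1)).subtype _

lemma mem_regionSites {W X : ℤ} {a b : ℕ} {s : Site} : s ∈ regionSites W X a b ↔
    (a ≤ s.1.1 ∧ s.1.1 < b) ∧ (X - 1) * W + 1 ≤ s.1.2 ∧ s.1.2 ≤ (X + 1) * W - 1 := by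
  simp [regionSites, Finset.mem_subtype]

lemma card_regionSites_le (W : ℕ) (X : ℤ) (a R : ℕ) :
    (regionSites W X a (a + R)).card ≤ 2 * R * W := by
  classical
  unfold regionSites
  rw [Finset.card_subtype]
  refine (Finset.card_filter_le _ _).trans ?_
  rw [Finset.card_product, Nat.card_Ico, Int.card_Icc, Nat.add_sub_cancel_left,
    mul_comm 2 R, mul_assoc]
  refine Nat.mul_le_mul_left _ ?_
  have : (X + 1) * (W : ℤ) - 1 + 1 - ((X - 1) * W + 1) = 2 * W - 1 := by ring
  rw [this]
  omega

/-- The sites visited by the zigzag of length `t` that starts from the lane `y` at time `n`. -/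
def zigzagSites (n t : ℕ) (y : {y : ℤ // Even ((n : ℤ) + y)}) : Finset Site :=
  (Finset.range t).image fun i ↦ ⟨(n + i, y + (i % 2 : ℕ)), by
    have := y.2; push_cast; rw [Int.even_iff] at *; omega⟩

lemma mem_zigzagSites {n t : ℕ} {y : {y : ℤ // Even ((n : ℤ) + y)}} {s : Site} :
    s ∈ zigzagSites n t y ↔ ∃ i < t, s.1 = (n + i, y.1 + (i % 2 : ℕ)) := by
  simp only [zigzagSites, Finset.mem_image, Finset.mem_range, Subtype.ext_iff, eq_comm]

lemma prod_zigzagSites (n t : ℕ) (y : {y : ℤ // Even ((n : ℤ) + y)}) (f : ℕ → ℝ) :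
    ∏ s ∈ zigzagSites n t y, f s.1.1 = ∏ i ∈ Finset.range t, f (n + i) := by
  unfold zigzagSites
  rw [Finset.prod_image]
  intro i _ j _ h
  simp only [Subtype.mk.injEq, Prod.mk.injEq] at h
  omega

section Block

variable {Ω : Type*} {mΩ : MeasurableSpace Ω} {μ : Measure Ω}

/-- The event that a block is open. -/
def blockEvent (E : ℕ × ℤ → Set Ω) (W X : ℤ) (a b : ℕ) : Set Ω :=
  {ω | BlockOpen (fun p ↦ ω ∈ E p) W X a b}

lemma measurableSet_blockEvent_generateFrom (E : ℕ × ℤ → Set Ω) (W X : ℤ) (a b : ℕ) :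
    MeasurableSet[⨆ s ∈ (regionSites W X a b : Set Site), generateFrom {E s.1}]
      (blockEvent E W X a b) := by
  classical
  let Φ : (Site → Prop) → Prop := fun η ↦
    BlockOpen (fun p ↦ if h : Even ((p.1 : ℤ) + p.2) then η ⟨p, h⟩ else False) W X a b
  have heq : blockEvent E W X a b = {ω | Φ fun s ↦ ω ∈ E s.1} := by
    ext ω
    exact BlockOpen.congr fun n y _ _ _ _ h ↦ by simp [h]
  rw [heq]
  refine measurableSet_of_finite_dependence (fun s : Site ↦ E s.1) (regionSites W X a b) Φ ?_
  intro η η' h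
  refine BlockOpen.congr fun n y h1 h2 h3 h4 h5 ↦ ?_
  simp only [h5, dif_pos]
  exact h ⟨(n, y), h5⟩ (mem_regionSites.2 ⟨⟨h1, h2⟩, h3, h4⟩)

lemma measurableSet_blockEvent {E : ℕ × ℤ → Set Ω} (hE : ∀ p, MeasurableSet (E p)) (W X : ℤ)
    (a b : ℕ) : MeasurableSet (blockEvent E W X a b) := by
  have hle : (⨆ s ∈ (regionSites W X a b : Set Site), generateFrom {E s.1}) ≤ mΩ :=
    iSup₂_le fun s _ ↦ generateFrom_le fun t ht ↦ by
      rw [Set.mem_singleton_iff.1 ht]; exact hE s.1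
  exact hle _ (measurableSet_blockEvent_generateFrom E W X a b)

/-- The blocks cut out by an increasing sequence of times are independent. -/
lemma iIndepSet_blockEvent {E : ℕ × ℤ → Set Ω} (hE : ∀ p, MeasurableSet (E p))
    (h : iIndepSet (fun s : Site ↦ E s.1) μ) {W : ℤ} (hW : 0 < W) {c : ℕ → ℕ} (hc : Monotone c) :
    iIndepSet (fun s : Site ↦ blockEvent E W s.1.2 (c s.1.1) (c (s.1.1 + 1))) μ := by
  refine iIndepSet_of_disjoint (E := fun s : Site ↦ E s.1) (fun s ↦ hE s.1) h
    (S := fun s : Site ↦ (regionSites W s.1.2 (c s.1.1) (c (s.1.1 + 1)) : Set Site))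
    (F := fun s : Site ↦ blockEvent E W s.1.2 (c s.1.1) (c (s.1.1 + 1))) ?_
    fun s ↦ measurableSet_blockEvent_generateFrom E W s.1.2 (c s.1.1) (c (s.1.1 + 1))
  rintro ⟨⟨N, X⟩, hX⟩ ⟨⟨N', X'⟩, hX'⟩ hne
  rw [Finset.disjoint_coe, Finset.disjoint_left]
  intro s hs hs'
  rw [mem_regionSites] at hs hs'
  simp only at hs hs' hX hX'
  have hN : N = N' := by
    by_contra hN
    rcases Nat.lt_or_gt_of_ne hN with hlt | hlt
    · have := hc (show N + 1 ≤ N' by omega); omega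
    · have := hc (show N' + 1 ≤ N by omega); omega
  subst hN
  have hXX : X ≠ X' := by rintro rfl; exact hne rfl
  -- Blocks of the same column have centres of the same parity. Consecutive ones overlap only on the
  -- lane `(X + 1) * W`, which the strict bounds on the region leave out.
  have hle : X + 2 ≤ X' ∨ X' + 2 ≤ X := by
    rw [Int.even_iff] at hX hX'; omega
  rcases hle with hle | hle
  · have : (X + 1) * W ≤ (X' - 1) * W := mul_le_mul_of_nonneg_right (by omega) hW.le
    omega
  · have : (X' + 1) * W ≤ (X - 1) * W := mul_le_mul_of_nonneg_right (by omega) hW.le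
    omega

/-- Starting lanes of the same parity differ by at least two, while a zigzag uses only `y` and `y +
1`. -/
lemma disjoint_zigzagSites {n t : ℕ} {y y' : {y : ℤ // Even ((n : ℤ) + y)}} (h : y ≠ y') :
    Disjoint (zigzagSites n t y) (zigzagSites n t y') := by
  rw [Finset.disjoint_left]
  intro s hs hs'
  obtain ⟨i, hi, h1⟩ := mem_zigzagSites.1 hs
  obtain ⟨j, hj, h2⟩ := mem_zigzagSites.1 hs'
  rw [h1, Prod.mk.injEq] at h2
  have h3 := y.2
  have h4 := y'.2
  rw [Int.even_iff] at h3 h4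
  have : y.1 ≠ y'.1 := fun h' ↦ h (Subtype.ext h')
  obtain ⟨h5, h6⟩ := h2
  obtain rfl : i = j := by omega
  omega

/-- The lane of the `j`-th trial in the block `X` at time `n`. -/
def trialLane (W X : ℤ) (n : ℕ) (j : ℕ) : {y : ℤ // Even ((n : ℤ) + y)} :=
  ⟨(X - 1) * W + 3 + ((n : ℤ) + ((X - 1) * W + 3)) % 2 + 2 * j, by
    rw [Int.even_iff]; omega⟩

lemma trialLane_injective (W X : ℤ) (n : ℕ) : Function.Injective (trialLane W X n) := by
  intro i j h
  simp only [trialLane, Subtype.mk.injEq] at h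
  omega

lemma trialLane_mem {W X : ℤ} {n j : ℕ} (hj : (j : ℤ) + 4 ≤ W) :
    (X - 1) * W + 3 ≤ (trialLane W X n j).1 ∧ (trialLane W X n j).1 ≤ (X + 1) * W - 4 ∧
      Even ((n : ℤ) + (trialLane W X n j).1) := by
  have hexp : (X + 1) * W = (X - 1) * W + 2 * W := by ring
  refine ⟨?_, ?_, (trialLane W X n j).2⟩ <;> simp only [trialLane] <;> omega

lemma prod_le_prod_zigzagSites {E : ℕ × ℤ → Set Ω} {f : ℕ → ℝ} {t : ℕ} {π : ℝ} (hf0 : ∀ n, 0 ≤ f n)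
    (hf : ∀ s : Site, f s.1.1 ≤ μ.real (E s.1)) (n : ℕ) (y : {y : ℤ // Even ((n : ℤ) + y)})
    (hπ : π ≤ ∏ i ∈ Finset.range t, f (n + i)) :
    π ≤ ∏ s ∈ zigzagSites n t y, μ.real (E s.1) := by
  rw [← prod_zigzagSites n t y] at hπ
  exact hπ.trans (Finset.prod_le_prod (fun s _ ↦ hf0 _) fun s _ ↦ hf s)

variable [IsProbabilityMeasure μ] {E : ℕ × ℤ → Set Ω} {f : ℕ → ℝ} {a R t W : ℕ} {X : ℤ} {ε π : ℝ}

lemma exists_forall_of_not_two_closed {ω : Ω} {b : ℕ}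
    (h : ¬ ∃ i ∈ regionSites W X a b, ∃ j ∈ regionSites W X a b, i ≠ j ∧ ω ∉ E i.1 ∧ ω ∉ E j.1) :
    ∃ q : ℕ × ℤ, ∀ i y, a ≤ i → i < b → (X - 1) * W + 1 ≤ y → y ≤ (X + 1) * W - 1 →
      Even ((i : ℤ) + y) → q ≠ (i, y) → ω ∈ E (i, y) := by
  push Not at h
  by_cases hex : ∃ q ∈ regionSites W X a b, ω ∉ E q.1
  · obtain ⟨q, hq, hq'⟩ := hex
    refine ⟨q.1, fun i y h1 h2 h3 h4 h5 h6 ↦ ?_⟩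
    exact h q hq ⟨(i, y), h5⟩ (mem_regionSites.2 ⟨⟨h1, h2⟩, h3, h4⟩)
      (fun h' ↦ h6 (congrArg Subtype.val h')) hq'
  · push Not at hex
    -- No site is closed, so any exceptional site will do.
    exact ⟨(0, 0), fun i y h1 h2 h3 h4 h5 _ ↦
      hex ⟨(i, y), h5⟩ (mem_regionSites.2 ⟨⟨h1, h2⟩, h3, h4⟩)⟩

/-- A block with a mild defect is open with a probability close to one. -/
lemma measureReal_blockEvent_ge_of_mild (hE : ∀ p, MeasurableSet (E p))
    (h : iIndepSet (fun s : Site ↦ E s.1) μ) (hf0 : ∀ n, 0 ≤ f n)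
    (hf : ∀ s : Site, f s.1.1 ≤ μ.real (E s.1)) (hε : 0 ≤ ε)
    (h₁ : ∀ n, a ≤ n → n < a + R → 1 - ε ≤ f n)
    (h₃ : ∀ n, a + R + t ≤ n → n < a + R + t + R → 1 - ε ≤ f n)
    (hπ : π ≤ ∏ i ∈ Finset.range t, f (a + R + i))
    {M : ℕ} (hW : 10 ≤ W) (hMW : 2 * M + 3 ≤ W) (hR : 2 * W + 4 ≤ R) :
    1 - (2 * (2 * R * W * ε) ^ 2 + 2 * (1 - π) ^ M) ≤
      μ.real (blockEvent E W X a (a + R + t + R)) := by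
  have two : ∀ a' : ℕ, (∀ n, a' ≤ n → n < a' + R → 1 - ε ≤ f n) →
      μ.real {ω | ∃ i ∈ regionSites W X a' (a' + R), ∃ j ∈ regionSites W X a' (a' + R),
        i ≠ j ∧ ω ∉ E i.1 ∧ ω ∉ E j.1} ≤ (2 * R * W * ε) ^ 2 := by
    intro a' ha'
    refine (measureReal_two_fail_le (E := fun s : Site ↦ E s.1) (fun s ↦ hE s.1) h _
      (ε := ε) fun s hs ↦ ?_).trans ?_
    · have := (mem_regionSites.1 hs).1
      exact (ha' _ this.1 this.2).trans (hf s)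
    · have : ((regionSites W X a' (a' + R)).card : ℝ) ≤ 2 * R * W := by
        exact_mod_cast card_regionSites_le W X a' R
      gcongr
  have trials : ∀ J : Finset ℕ, J.card = M →
      μ.real (⋂ j ∈ J, (⋂ s ∈ zigzagSites (a + R) t (trialLane W X (a + R) j), E s.1)ᶜ) ≤
        (1 - π) ^ M := by
    intro J hJ
    rw [← hJ]
    exact measureReal_trials_fail_le (E := fun s : Site ↦ E s.1) (fun s ↦ hE s.1) h
      (fun j ↦ zigzagSites (a + R) t (trialLane W X (a + R) j))
      (fun i j hij ↦ disjoint_zigzagSites fun h' ↦ hij (trialLane_injective _ _ _ h'))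
      (fun j ↦ prod_le_prod_zigzagSites hf0 hf _ _ hπ) J
  set B₁ := {ω | ∃ i ∈ regionSites W X a (a + R), ∃ j ∈ regionSites W X a (a + R),
        i ≠ j ∧ ω ∉ E i.1 ∧ ω ∉ E j.1}
  set B₃ := {ω | ∃ i ∈ regionSites W X (a + R + t) (a + R + t + R),
    ∃ j ∈ regionSites W X (a + R + t) (a + R + t + R), i ≠ j ∧ ω ∉ E i.1 ∧ ω ∉ E j.1}
  set C₁ := ⋂ j ∈ Finset.range M,
    (⋂ s ∈ zigzagSites (a + R) t (trialLane W X (a + R) j), E s.1)ᶜ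
  set C₂ := ⋂ j ∈ Finset.Ico M (2 * M),
    (⋂ s ∈ zigzagSites (a + R) t (trialLane W X (a + R) j), E s.1)ᶜ
  -- A closed block has two closed sites in one of the good stretches, or one of the two disjoint
  -- groups of `M` trials fails entirely. Two groups guarantee two distinct surviving zigzags.
  have hsub : Set.univ ⊆ blockEvent E W X a (a + R + t + R) ∪ ((B₁ ∪ B₃) ∪ (C₁ ∪ C₂)) := by
    intro ω _
    by_contra hω
    simp only [Set.mem_union, not_or] at hω
    obtain ⟨hb, ⟨hB₁, hB₃⟩, hC₁, hC₂⟩ := hω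
    obtain ⟨q, hq⟩ := exists_forall_of_not_two_closed hB₁
    obtain ⟨q', hq'⟩ := exists_forall_of_not_two_closed hB₃
    have succ : ∀ J : Finset ℕ, ω ∉ (⋂ j ∈ J,
        (⋂ s ∈ zigzagSites (a + R) t (trialLane W X (a + R) j), E s.1)ᶜ) → ∃ j ∈ J,
        ∀ i < t, ω ∈ E (a + R + i, (trialLane W X (a + R) j).1 + (i % 2 : ℕ)) := by
      intro J hJ
      simp only [Set.mem_iInter, Set.mem_compl_iff] at hJ
      push Not at hJ
      obtain ⟨j, hj, hj'⟩ := hJ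
      refine ⟨j, hj, fun i hi ↦ hj' ⟨(a + R + i, (trialLane W X (a + R) j).1 + (i % 2 : ℕ)), ?_⟩
        (mem_zigzagSites.2 ⟨i, hi, rfl⟩)⟩
      have := (trialLane W X (a + R) j).2
      push_cast at *; rw [Int.even_iff] at *; omega
    obtain ⟨j, hj, hj'⟩ := succ _ hC₁
    obtain ⟨k, hk, hk'⟩ := succ _ hC₂
    rw [Finset.mem_range] at hj
    rw [Finset.mem_Ico] at hk
    refine hb (blockOpen_of_two_trials (by omega) (by omega) q q' hq hq' _ _ ?_
      (trialLane_mem (j := j) (by omega)) (trialLane_mem (j := k) (by omega)) hj' hk')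
    intro h'
    have := trialLane_injective _ _ _ (Subtype.ext h')
    omega
  have h1 := measureReal_mono (μ := μ) hsub
  rw [probReal_univ] at h1
  have h2 := measureReal_union_le (μ := μ) (blockEvent E W X a (a + R + t + R))
    ((B₁ ∪ B₃) ∪ (C₁ ∪ C₂))
  have h3 := measureReal_union_le (μ := μ) (B₁ ∪ B₃) (C₁ ∪ C₂)
  have h4 := measureReal_union_le (μ := μ) B₁ B₃
  have h5 := measureReal_union_le (μ := μ) C₁ C₂
  have h6 := two a h₁
  have h7 := two (a + R + t) h₃
  have h8 := trials (Finset.range M) (by simp)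
  have h9 := trials (Finset.Ico M (2 * M)) (by simp; omega)
  linarith

/-- A block with a severe defect is open as soon as one trial succeeds and the other sites are
open. -/
lemma measureReal_blockEvent_ge_of_severe (hE : ∀ p, MeasurableSet (E p))
    (h : iIndepSet (fun s : Site ↦ E s.1) μ) (hf0 : ∀ n, 0 ≤ f n)
    (hf : ∀ s : Site, f s.1.1 ≤ μ.real (E s.1)) (hε : 0 ≤ ε)
    (h₁ : ∀ n, a ≤ n → n < a + R → 1 - ε ≤ f n)
    (h₃ : ∀ n, a + R + t ≤ n → n < a + R + t + R → 1 - ε ≤ f n)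
    (hπ : π ≤ ∏ i ∈ Finset.range t, f (a + R + i)) (hπ0 : 0 ≤ π) (hπ1 : π ≤ 1)
    {m : ℕ} (hW : 10 ≤ W) (hMW : m + 3 ≤ W) (hR : 2 * W + 4 ≤ R) (hRW : 2 * (2 * R * W * ε) ≤ 1) :
    (1 - 2 * (2 * R * W * ε)) * (1 - (1 - π) ^ m) ≤
      μ.real (blockEvent E W X a (a + R + t + R)) := by
  classical
  -- Here only a lower bound of the order of the crossing probability is wanted, so all sites of the
  -- good stretches may be required to be open.
  set A := regionSites W X a (a + R) ∪ regionSites W X (a + R + t) (a + R + t + R) with hA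
  have hcard : (A.card : ℝ) ≤ 2 * (2 * R * W) := by
    have h1 := Finset.card_union_le (regionSites W X a (a + R))
      (regionSites W X (a + R + t) (a + R + t + R))
    have h2 := card_regionSites_le W X a R
    have h3 := card_regionSites_le W X (a + R + t) R
    have h4 : A.card ≤ 2 * (2 * R * W) := by rw [hA]; linarith
    exact_mod_cast h4
  have hcard' : A.card * ε ≤ 2 * (2 * R * W * ε) := by
    calc _ ≤ 2 * (2 * R * W) * ε := by gcongr
      _ = _ := by ring
  have key := measureReal_trial_ge (E := fun s : Site ↦ E s.1) (fun s ↦ hE s.1) h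
    (fun j ↦ zigzagSites (a + R) t (trialLane W X (a + R) j))
    (fun i j hij ↦ disjoint_zigzagSites fun h' ↦ hij (trialLane_injective _ _ _ h'))
    (fun j ↦ prod_le_prod_zigzagSites hf0 hf _ _ hπ) (Finset.range m) A (fun j ↦ by
      rw [Finset.disjoint_left]
      intro s hs hs'
      obtain ⟨i, hi, h1⟩ := mem_zigzagSites.1 hs'
      rw [Prod.ext_iff] at h1
      rw [hA, Finset.mem_union, mem_regionSites, mem_regionSites] at hs
      omega) (ε := ε) (fun s hs ↦ by
      rw [hA, Finset.mem_union, mem_regionSites, mem_regionSites] at hs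
      rcases hs with hs | hs
      · exact (h₁ _ hs.1.1 hs.1.2).trans (hf s)
      · exact (h₃ _ hs.1.1 hs.1.2).trans (hf s)) (by linarith)
  rw [Finset.card_range] at key
  have hle : (1 - π) ^ m ≤ 1 := pow_le_one₀ (by linarith) (by linarith)
  refine (mul_le_mul_of_nonneg_right (by linarith) (by linarith)).trans (key.trans ?_)
  refine measureReal_mono ?_ (measure_ne_top _ _)
  rintro ω ⟨h1, h2⟩
  simp only [Set.mem_iInter, Set.mem_compl_iff] at h1 h2
  push Not at h2
  obtain ⟨j, hj, hj'⟩ := h2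
  rw [Finset.mem_range] at hj
  refine blockOpen_of_trial (by omega) (by omega) (fun i y h3 h4 h5 h6 h7 ↦ ?_)
    (fun i y h3 h4 h5 h6 h7 ↦ ?_) _ (trialLane_mem (j := j) (by omega)) fun i hi ↦ ?_
  · exact h1 ⟨(i, y), h7⟩ (Finset.mem_union_left _ (mem_regionSites.2 ⟨⟨h3, h4⟩, h5, h6⟩))
  · exact h1 ⟨(i, y), h7⟩ (Finset.mem_union_right _ (mem_regionSites.2 ⟨⟨h3, h4⟩, h5, h6⟩))
  · refine hj' ⟨(a + R + i, (trialLane W X (a + R) j).1 + (i % 2 : ℕ)), ?_⟩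
      (mem_zigzagSites.2 ⟨i, hi, rfl⟩)
    have := (trialLane W X (a + R) j).2
    push_cast at *; rw [Int.even_iff] at *; omega

end Block

end OrientedPercolation

/-! ### Labels, scales and one step of the renormalization -/

namespace OrientedPercolation

open MeasureTheory ProbabilityTheory

/-- The cost of crossing a column with a given label: a positive label `l` counts `l + 1`. -/
def cost (l : ℕ) : ℕ := if l = 0 then 0 else l + 1

/-- The lower bound for the probability that a site of a column with a given label is open. -/
noncomputable def siteBound (ε : ℝ) (l : ℕ) : ℝ := if l = 0 then 1 - ε else (1 / 2) ^ l

/-- The times `c N` cut the sequence of labels `v` into blocks with labels `v'`: each cut is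
surrounded by runs of `R` vanishing labels, and the label of a block is the total cost of its
columns, diminished by `g`. -/
structure Renormalizes (R g : ℕ) (v c v' : ℕ → ℕ) : Prop where
  le_first : R ≤ c 0
  length (N : ℕ) : c N + 2 * R ≤ c (N + 1)
  good_left (N n : ℕ) : c N ≤ n → n < c N + R → v n = 0
  good_right (N n : ℕ) : c (N + 1) ≤ n + R → n < c (N + 1) → v n = 0
  label (N : ℕ) : v' N = ∑ n ∈ Finset.Ico (c N + R) (c (N + 1) - R), cost (v n) - g
  zeros (N : ℕ) : {n ∈ Finset.Ico (c N + R) (c (N + 1) - R) | v n = 0}.card ≤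
    2 * R * {n ∈ Finset.Ico (c N + R) (c (N + 1) - R) | v n ≠ 0}.card
  first_good : (∀ n < 2 * R, v n = 0) → c 0 = R

lemma Renormalizes.monotone {R g : ℕ} {v c v' : ℕ → ℕ} (h : Renormalizes R g v c v') :
    Monotone c :=
  monotone_nat_of_le_succ fun N ↦ by have := h.length N; omega

lemma siteBound_nonneg {ε : ℝ} (hε : ε ≤ 1) (l : ℕ) : 0 ≤ siteBound ε l := by
  unfold siteBound
  split_ifs
  · linarith
  · positivity

/-- The probability of crossing a set of columns along a given path. -/
lemma pow_sum_cost_le_prod {ε : ℝ} {R : ℕ} (hε : ε ≤ 1) (hε0 : 0 ≤ ε) (hR : 2 * R * ε ≤ 1 / 2)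
    (v : ℕ → ℕ)
    (A : Finset ℕ) (hA : {n ∈ A | v n = 0}.card ≤ 2 * R * {n ∈ A | v n ≠ 0}.card) :
    (1 / 2 : ℝ) ^ (∑ n ∈ A, cost (v n)) ≤ ∏ n ∈ A, siteBound ε (v n) := by
  -- By Bernoulli's inequality, crossing `2 * R` good columns costs at most a factor `1 / 2`. The
  -- extra unit in the cost of each defect pays for its share of at most `2 * R` good columns.
  have hb : (1 / 2 : ℝ) ≤ (1 - ε) ^ (2 * R) := by
    have := one_add_mul_le_pow (a := -ε) (by linarith) (2 * R)
    push_cast at this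
    rw [← sub_eq_add_neg] at this
    linarith
  rw [← Finset.prod_filter_mul_prod_filter_not A (fun n ↦ v n = 0),
    ← Finset.sum_filter_add_sum_filter_not A (fun n ↦ v n = 0)]
  have h1 : ∑ n ∈ A with v n = 0, cost (v n) = 0 :=
    Finset.sum_eq_zero fun n hn ↦ by simp [cost, (Finset.mem_filter.1 hn).2]
  have h2 : ∑ n ∈ A with ¬ v n = 0, cost (v n) =
      ∑ n ∈ A with ¬ v n = 0, v n + {n ∈ A | v n ≠ 0}.card := by
    rw [Finset.card_eq_sum_ones, ← Finset.sum_add_distrib]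
    exact Finset.sum_congr rfl fun n hn ↦ by simp [cost, (Finset.mem_filter.1 hn).2]
  have h3 : ∏ n ∈ A with v n = 0, siteBound ε (v n) = (1 - ε) ^ {n ∈ A | v n = 0}.card := by
    rw [← Finset.prod_const]
    exact Finset.prod_congr rfl fun n hn ↦ by simp [siteBound, (Finset.mem_filter.1 hn).2]
  have h4 : ∏ n ∈ A with ¬ v n = 0, siteBound ε (v n) =
      (1 / 2) ^ ∑ n ∈ A with ¬ v n = 0, v n := by
    rw [← Finset.prod_pow_eq_pow_sum]
    exact Finset.prod_congr rfl fun n hn ↦ by simp [siteBound, (Finset.mem_filter.1 hn).2]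
  rw [h1, h2, h3, h4, zero_add, pow_add, mul_comm]
  gcongr
  calc (1 / 2 : ℝ) ^ {n ∈ A | v n ≠ 0}.card ≤ ((1 - ε) ^ (2 * R)) ^ {n ∈ A | v n ≠ 0}.card := by
        gcongr
    _ = (1 - ε) ^ (2 * R * {n ∈ A | v n ≠ 0}.card) := by rw [pow_mul (1 - ε) (2 * R)]
    _ ≤ _ := pow_le_pow_of_le_one (by linarith) (by linarith) hA

section Scales

/-- The width of the blocks of level `k + 1`, in lanes of level `k`. -/
@[irreducible] def width (k : ℕ) : ℕ := 2 ^ (2 * k + 25)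

/-- The length of the runs of good columns around the cuts of level `k`. -/
@[irreducible] def runLength (k : ℕ) : ℕ := 2 ^ (2 * k + 27)

/-- The gain in the labels from level `k` to level `k + 1`. -/
@[irreducible] def gain (k : ℕ) : ℕ := k + 9

/-- The bound for the probability that a site is closed in a good column of level `k`. -/
noncomputable def failBound (k : ℕ) : ℝ := (1 / 2) ^ (150 + 10 * k)

lemma ten_le_width (k : ℕ) : 10 ≤ width k := by
  have h1 : 1 ≤ 2 ^ (2 * k) := Nat.one_le_two_pow
  have h2 : 2 ^ (2 * k + 25) = 2 ^ 25 * 2 ^ (2 * k) := by ring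
  unfold width
  omega

lemma two_mul_width_add_four_le (k : ℕ) : 2 * width k + 4 ≤ runLength k := by
  have h1 := ten_le_width k
  have h2 : runLength k = 4 * width k := by unfold runLength width; ring
  omega

lemma trials_add_three_le (k : ℕ) : 2 * 2 ^ (2 * k + 23) + 3 ≤ width k := by
  have h1 := ten_le_width k
  have h2 : width k = 4 * 2 ^ (2 * k + 23) := by unfold width; ring
  omega

lemma trials_sqrt_add_three_le (k : ℕ) : 2 ^ (k + 12) + 3 ≤ width k := by
  have h1 := trials_add_three_le k
  have h2 : 2 ^ (k + 12) ≤ 2 ^ (2 * k + 23) := Nat.pow_le_pow_right (by norm_num) (by omega)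
  omega

/-- This bounds the expected number of closed sites in a good stretch of a block. It exceeds
`failBound k`, but its square is far below `failBound (k + 1)`, which is why one closed site must be
tolerated. -/
lemma two_mul_runLength_mul_width (k : ℕ) :
    2 * (runLength k : ℝ) * width k * failBound k = (1 / 2) ^ (97 + 6 * k) := by
  have : (2 * (runLength k : ℝ) * width k) = 2 ^ (53 + 4 * k) := by
    simp only [runLength, width]
    push_cast
    ring
  rw [this, failBound, show 150 + 10 * k = (53 + 4 * k) + (97 + 6 * k) by ring,
    pow_add (1 / 2 : ℝ) (53 + 4 * k), ← mul_assoc, ← mul_pow]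
  norm_num

lemma le_two_pow_add (k : ℕ) : 162 + 10 * k ≤ 2 ^ (k + 14) := by
  have : k < 2 ^ k := Nat.lt_two_pow_self
  rw [pow_add]
  omega

lemma failBound_nonneg (k : ℕ) : 0 ≤ failBound k := by unfold failBound; positivity

lemma failBound_le_one (k : ℕ) : failBound k ≤ 1 := pow_le_one₀ (by norm_num) (by norm_num)

lemma one_sub_pow_le_exp {π : ℝ} (h1 : π ≤ 1) (n : ℕ) : (1 - π) ^ n ≤ Real.exp (-(n * π)) := by
  calc (1 - π) ^ n ≤ Real.exp (-π) ^ n := by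
        gcongr
        exact Real.one_sub_le_exp_neg π
    _ = _ := by rw [← Real.exp_nat_mul]; ring_nf

/-- Each term is at most half of `failBound (k + 1)`. In the second one, at least `2 ^ (2 * k + 23)
* 2 ^ (-(k + 9)) = 2 ^ (k + 14)` successes are expected, so that failure is doubly exponentially
unlikely in `k`. -/
lemma mild_bound (k : ℕ) {σ : ℕ} (hσ : σ ≤ gain k) :
    2 * (2 * runLength k * width k * failBound k) ^ 2 +
      2 * (1 - (1 / 2 : ℝ) ^ σ) ^ 2 ^ (2 * k + 23) ≤ failBound (k + 1) := by
  rw [two_mul_runLength_mul_width]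
  have h1 : 2 * ((1 / 2 : ℝ) ^ (97 + 6 * k)) ^ 2 ≤ (1 / 2) ^ (161 + 10 * k) := by
    rw [← pow_mul]
    calc 2 * (1 / 2 : ℝ) ^ ((97 + 6 * k) * 2) = (1 / 2) ^ (193 + 12 * k) := by
          rw [show (97 + 6 * k) * 2 = (193 + 12 * k) + 1 by ring, pow_succ]; ring
      _ ≤ _ := pow_le_pow_of_le_one (by norm_num) (by norm_num) (by omega)
  have h2 : 2 * (1 - (1 / 2 : ℝ) ^ σ) ^ 2 ^ (2 * k + 23) ≤ (1 / 2) ^ (161 + 10 * k) := by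
    have hπ : (1 / 2 : ℝ) ^ gain k ≤ (1 / 2) ^ σ :=
      pow_le_pow_of_le_one (by norm_num) (by norm_num) hσ
    have h3 := one_sub_pow_le_exp (π := (1 / 2 : ℝ) ^ σ) (pow_le_one₀ (by norm_num) (by norm_num))
      (2 ^ (2 * k + 23))
    have h4 : (2 : ℝ) ^ (k + 14) ≤ ((2 ^ (2 * k + 23) : ℕ) : ℝ) * (1 / 2 : ℝ) ^ σ := by
      calc (2 : ℝ) ^ (k + 14) = 2 ^ (2 * k + 23) * (1 / 2) ^ gain k := by
            rw [gain, show 2 * k + 23 = (k + 14) + (k + 9) by ring, pow_add 2 (k + 14), mul_assoc,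
              ← mul_pow]
            norm_num
        _ ≤ _ := by push_cast; gcongr
    have h5 : Real.exp (-(2 : ℝ) ^ (k + 14)) ≤ (1 / 2) ^ 2 ^ (k + 14) := by
      have he : Real.exp (-1) ≤ 1 / 2 := by
        rw [Real.exp_neg, one_div]
        exact inv_anti₀ (by norm_num) (by linarith [Real.exp_one_gt_d9])
      calc Real.exp (-(2 : ℝ) ^ (k + 14)) = Real.exp (-1) ^ 2 ^ (k + 14) := by
            rw [← Real.exp_nat_mul]; push_cast; ring_nf
        _ ≤ _ := by gcongr
    have h6 : (1 / 2 : ℝ) ^ 2 ^ (k + 14) ≤ (1 / 2) ^ (162 + 10 * k) :=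
      pow_le_pow_of_le_one (by norm_num) (by norm_num) (le_two_pow_add k)
    have h7 : (1 / 2 : ℝ) ^ (162 + 10 * k) = (1 / 2) ^ (161 + 10 * k) * (1 / 2) := by
      rw [← pow_succ]; ring_nf
    have h8 : Real.exp (-(((2 ^ (2 * k + 23) : ℕ) : ℝ) * (1 / 2 : ℝ) ^ σ)) ≤
        Real.exp (-(2 : ℝ) ^ (k + 14)) := Real.exp_le_exp.2 (by linarith)
    linarith
  have h3 : failBound (k + 1) = (1 / 2) ^ (161 + 10 * k) + (1 / 2) ^ (161 + 10 * k) := by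
    rw [failBound, show 161 + 10 * k = (150 + 10 * (k + 1)) + 1 by ring, pow_succ]; ring
  linarith

/-- With `σ = gain k + d + 1`, the expected number of successful trials is `x = 4 * 2 ^ (-d) ≤ 4`.
Then `1 - exp (-x) ≥ x / (1 + x) ≥ x / 5`, whereas the target is `x / 8`. Using only `2 ^ (k + 12)`
trials keeps `x` bounded, so that this linear bound is uniform. -/
lemma severe_bound (k : ℕ) {σ : ℕ} (hσ : gain k < σ) :
    (1 / 2 : ℝ) ^ (σ - gain k) ≤ (1 - 2 * (2 * runLength k * width k * failBound k)) *
      (1 - (1 - (1 / 2 : ℝ) ^ σ) ^ 2 ^ (k + 12)) := by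
  rw [two_mul_runLength_mul_width]
  obtain ⟨d, rfl⟩ := Nat.exists_eq_add_of_lt hσ
  have h1 : (1 / 2 : ℝ) ^ (97 + 6 * k) ≤ (1 / 2) ^ 97 :=
    pow_le_pow_of_le_one (by norm_num) (by norm_num) (by omega)
  have h2 : (1 / 2 : ℝ) ^ 97 ≤ 1 / 20 := by norm_num
  set π : ℝ := (1 / 2) ^ (gain k + d + 1)
  have hπ1 : π ≤ 1 := pow_le_one₀ (by norm_num) (by norm_num)
  have h3 := one_sub_pow_le_exp hπ1 (2 ^ (k + 12))
  set x : ℝ := ((2 ^ (k + 12) : ℕ) : ℝ) * π with hx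
  have hxd : x = 4 * (1 / 2) ^ d := by
    have : (2 : ℝ) ^ k * (1 / 2) ^ k = 1 := by rw [← mul_pow]; norm_num
    rw [hx]
    simp only [π, gain]
    push_cast
    calc (2 : ℝ) ^ (k + 12) * (1 / 2) ^ (k + 9 + d + 1)
        = (2 ^ k * (1 / 2) ^ k) * (4 * (1 / 2) ^ d) := by ring
      _ = _ := by rw [this, one_mul]
  have hd1 : (1 / 2 : ℝ) ^ d ≤ 1 := pow_le_one₀ (by norm_num) (by norm_num)
  have hd0 : 0 < (1 / 2 : ℝ) ^ d := by positivity
  have h4 : Real.exp (-x) ≤ 1 / (1 + x) := by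
    rw [Real.exp_neg, one_div]
    exact inv_anti₀ (by linarith) (by linarith [Real.add_one_le_exp x])
  have h5 : x / 5 ≤ 1 - 1 / (1 + x) := by
    have hx0 : 0 < x := by linarith
    have : 1 - 1 / (1 + x) = x / (1 + x) := by field_simp; ring
    rw [this]
    gcongr
    linarith
  have h6 : (1 / 2 : ℝ) ^ (gain k + d + 1 - gain k) = x / 8 := by
    rw [show gain k + d + 1 - gain k = d + 1 by omega, hxd]; ring
  rw [h6]
  have h7 : x / 5 ≤ 1 - (1 - π) ^ 2 ^ (k + 12) := by linarith
  calc x / 8 ≤ (9 / 10) * (x / 5) := by linarith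
    _ ≤ _ := by
      apply mul_le_mul (by linarith) h7 (by linarith) (by linarith)

end Scales

/-- One step of the renormalization: the lower bounds for the probabilities of open sites are
preserved. -/
lemma siteBound_le_blockEvent {Ω : Type*} {mΩ : MeasurableSpace Ω} {μ : Measure Ω}
    [IsProbabilityMeasure μ] {E : ℕ × ℤ → Set Ω} (hE : ∀ p, MeasurableSet (E p))
    (h : iIndepSet (fun s : Site ↦ E s.1) μ) {k : ℕ} {v c v' : ℕ → ℕ}
    (hv : ∀ s : Site, siteBound (failBound k) (v s.1.1) ≤ μ.real (E s.1))
    (hr : Renormalizes (runLength k) (gain k) v c v') (N : ℕ) (X : ℤ) :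
    siteBound (failBound (k + 1)) (v' N) ≤
      μ.real (blockEvent E (width k) X (c N) (c (N + 1))) := by
  set R := runLength k with hR
  have hlen := hr.length N
  obtain ⟨t, ht⟩ : ∃ t, c (N + 1) = c N + R + t + R :=
    ⟨c (N + 1) - c N - 2 * R, by omega⟩
  have hW10 := ten_le_width k
  have hRW : 2 * width k + 4 ≤ R := two_mul_width_add_four_le k
  have hε := failBound_nonneg k
  have hε1 := failBound_le_one k
  have hfail := two_mul_runLength_mul_width k
  have hsmall : (1 / 2 : ℝ) ^ (97 + 6 * k) ≤ 1 / 4 := by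
    calc (1 / 2 : ℝ) ^ (97 + 6 * k) ≤ (1 / 2) ^ 2 :=
          pow_le_pow_of_le_one (by norm_num) (by norm_num) (by omega)
      _ = _ := by norm_num
  have h2R : 2 * (R : ℝ) * failBound k ≤ 1 / 2 := by
    have hw : (1 : ℝ) ≤ width k := Nat.one_le_cast.2 (by omega)
    have h0 : 0 ≤ 2 * (R : ℝ) * failBound k :=
      mul_nonneg (mul_nonneg zero_le_two (Nat.cast_nonneg _)) hε
    calc 2 * (R : ℝ) * failBound k ≤ 2 * (R : ℝ) * failBound k * width k :=
          le_mul_of_one_le_right h0 hw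
      _ = 2 * (R : ℝ) * width k * failBound k := by ring
      _ ≤ 1 / 2 := by linarith
  have hIco : Finset.Ico (c N + R) (c (N + 1) - R) =
      (Finset.range t).map (addLeftEmbedding (c N + R)) := by
    rw [Finset.range_eq_Ico, Finset.map_add_left_Ico]
    congr 1
    omega
  set σ := ∑ n ∈ Finset.Ico (c N + R) (c (N + 1) - R), cost (v n) with hσ
  have hπ : (1 / 2 : ℝ) ^ σ ≤
      ∏ i ∈ Finset.range t, siteBound (failBound k) (v (c N + R + i)) := by
    have := pow_sum_cost_le_prod hε1 hε h2R v _ (hr.zeros N)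
    rw [← hσ] at this
    refine this.trans_eq ?_
    rw [hIco, Finset.prod_map]
    rfl
  have h₁ : ∀ n, c N ≤ n → n < c N + R → 1 - failBound k ≤ siteBound (failBound k) (v n) :=
    fun n h1 h2 ↦ by simp [siteBound, hr.good_left N n h1 h2]
  have h₃ : ∀ n, c N + R + t ≤ n → n < c N + R + t + R →
      1 - failBound k ≤ siteBound (failBound k) (v n) :=
    fun n h1 h2 ↦ by simp [siteBound, hr.good_right N n (by omega) (by omega)]
  have hπ1 : (1 / 2 : ℝ) ^ σ ≤ 1 := pow_le_one₀ (by norm_num) (by norm_num)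
  rw [hr.label N, ← hσ, ht]
  -- The truncated subtraction makes the new label vanish exactly for mild defects.
  by_cases hσg : σ ≤ gain k
  · have key := measureReal_blockEvent_ge_of_mild (X := X) (f := fun n ↦ siteBound (failBound k) (v n))
      hE h (fun n ↦ siteBound_nonneg hε1 _) hv hε h₁ h₃ hπ (M := 2 ^ (2 * k + 23)) hW10
      (trials_add_three_le k) hRW
    have := mild_bound k hσg
    rw [Nat.sub_eq_zero_of_le hσg, siteBound, if_pos rfl]
    linarith
  · push Not at hσg
    have key := measureReal_blockEvent_ge_of_severe (X := X)
      (f := fun n ↦ siteBound (failBound k) (v n))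
      hE h (fun n ↦ siteBound_nonneg hε1 _) hv hε h₁ h₃ hπ (by positivity) hπ1
      (m := 2 ^ (k + 12)) hW10 (trials_sqrt_add_three_le k) hRW (by linarith)
    rw [siteBound, if_neg (by omega)]
    exact (severe_bound k hσg).trans key

end OrientedPercolation

/-! ### Cutting a sequence of labels at its long runs of zeros -/

namespace OrientedPercolation

open MeasureTheory ProbabilityTheory
open scoped ENNReal

section Parse

/-- The state of the parser: the length of the current run of zeros and the accumulated cost. -/
def parseStep (q : ℕ × ℕ) (a : ℕ) : ℕ × ℕ := if a = 0 then (q.1 + 1, q.2) else (0, q.2 + cost a)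

/-- The sequence without its first `n` terms. -/
def dropSeq (n : ℕ) (x : ℕ → ℕ) : ℕ → ℕ := fun i ↦ x (i + n)

/-- The state of the parser after `n` steps. -/
def parseState : ℕ → ℕ × ℕ → (ℕ → ℕ) → ℕ × ℕ
  | 0, q, _ => q
  | n + 1, q, x => parseState n (parseStep q (x 0)) (dropSeq 1 x)

/-- The parser sees its first run of `Q` zeros after `n` steps. -/
def ParseHits (Q : ℕ) : ℕ → ℕ × ℕ → (ℕ → ℕ) → Prop
  | 0, q, _ => q.1 = Q
  | n + 1, q, x => q.1 ≠ Q ∧ ParseHits Q n (parseStep q (x 0)) (dropSeq 1 x)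

variable {Q : ℕ}

lemma ParseHits.unique {n m : ℕ} {q : ℕ × ℕ} {x : ℕ → ℕ} (h : ParseHits Q n q x)
    (h' : ParseHits Q m q x) : n = m := by
  induction n generalizing m q x with
  | zero =>
    cases m with
    | zero => rfl
    | succ m => exact absurd h h'.1
  | succ n ih =>
    cases m with
    | zero => exact absurd h' h.1
    | succ m => rw [ih h.2 h'.2]

lemma ParseHits.state {n : ℕ} {q : ℕ × ℕ} {x : ℕ → ℕ} (h : ParseHits Q n q x) :
    (parseState n q x).1 = Q := by
  induction n generalizing q x with
  | zero => exact h
  | succ n ih => exact ih h.2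

lemma parseState_snd (n : ℕ) (q : ℕ × ℕ) (x : ℕ → ℕ) :
    (parseState n q x).2 = q.2 + ∑ i ∈ Finset.range n, cost (x i) := by
  induction n generalizing q x with
  | zero => simp [parseState]
  | succ n ih =>
    rw [parseState, ih, Finset.sum_range_succ']
    have : (parseStep q (x 0)).2 = q.2 + cost (x 0) := by
      unfold parseStep
      split_ifs with h
      · simp [h, cost]
      · rfl
    rw [this]
    simp only [dropSeq]
    ring

/-- Every non-zero term resets the counter, so the terms read last, as many as the counter shows,
all vanish. -/
lemma parseState_fst (n : ℕ) (q : ℕ × ℕ) (x : ℕ → ℕ) : (parseState n q x).1 ≤ q.1 + n ∧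
    ∀ i < n, n ≤ i + (parseState n q x).1 → x i = 0 := by
  induction n generalizing q x with
  | zero => simp [parseState]
  | succ n ih =>
    obtain ⟨h1, h2⟩ := ih (parseStep q (x 0)) (dropSeq 1 x)
    rw [parseState]
    refine ⟨h1.trans ?_, fun i hi hni ↦ ?_⟩
    · unfold parseStep
      split_ifs <;> simp <;> omega
    · cases i with
      | zero =>
        by_contra h0
        have : (parseStep q (x 0)).1 = 0 := by simp [parseStep, h0]
        omega
      | succ i => exact h2 i (by omega) (by omega)

/-- The indicator of zero. -/
def zeroInd (a : ℕ) : ℕ := if a = 0 then 1 else 0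

/-- Before the first run of `Q` zeros, each run of zeros is shorter than `Q` and is ended by a
non-zero term; the final run gives the last `Q`. The zeros of the run in progress at the start are
counted by `q.1`. -/
lemma ParseHits.zeros_le {n : ℕ} {q : ℕ × ℕ} {x : ℕ → ℕ} (h : ParseHits Q n q x) (hq : q.1 ≤ Q) :
    ∑ i ∈ Finset.range n, zeroInd (x i) + q.1 ≤
      Q * ∑ i ∈ Finset.range n, (1 - zeroInd (x i)) + Q := by
  induction n generalizing q x with
  | zero => simpa using hq
  | succ n ih =>
    rw [Finset.sum_range_succ', Finset.sum_range_succ']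
    have h1 := h.1
    by_cases h0 : x 0 = 0
    · have hs : parseStep q (x 0) = (q.1 + 1, q.2) := by simp [parseStep, h0]
      have h2 := h.2
      rw [hs] at h2
      have := ih h2 (by simp; omega)
      have hz : zeroInd (x 0) = 1 := by simp [zeroInd, h0]
      simp only [dropSeq] at this
      rw [hz, Nat.sub_self, add_zero]
      omega
    · have hs : (parseStep q (x 0)).1 = 0 := by simp [parseStep, h0]
      have := ih h.2 (by omega)
      rw [hs] at this
      have hz : zeroInd (x 0) = 0 := by simp [zeroInd, h0]
      simp only [dropSeq] at this
      rw [hz, Nat.sub_zero, mul_add, mul_one]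
      omega

lemma parseHits_of_zeros {n : ℕ} {q : ℕ × ℕ} {x : ℕ → ℕ} (hq : q.1 + n = Q)
    (hx : ∀ i < n, x i = 0) : ParseHits Q n q x := by
  induction n generalizing q x with
  | zero => exact hq
  | succ n ih =>
    refine ⟨by omega, ih ?_ fun i hi ↦ hx _ (by omega)⟩
    simp only [parseStep, hx 0 (by omega), if_true]
    omega

open Classical in
/-- The time of the end of the first run of `Q` zeros. -/
noncomputable def parseTime (Q : ℕ) (x : ℕ → ℕ) : ℕ :=
  if h : ∃ n, ParseHits Q n (0, 0) x then Nat.find h else 0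

/-- The total cost of the terms that precede the end of the first run of `Q` zeros. -/
noncomputable def parseCost (Q : ℕ) (x : ℕ → ℕ) : ℕ := (parseState (parseTime Q x) (0, 0) x).2

/-- The sequence after the first run of `Q` zeros. -/
noncomputable def parseRest (Q : ℕ) (x : ℕ → ℕ) : ℕ → ℕ := dropSeq (parseTime Q x) x

lemma parseHits_parseTime {x : ℕ → ℕ} (h : ∃ n, ParseHits Q n (0, 0) x) :
    ParseHits Q (parseTime Q x) (0, 0) x := by
  classical
  rw [parseTime, dif_pos h]
  exact Nat.find_spec h

/-- The labels of the renormalized environment. -/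
noncomputable def nextLabels (Q g : ℕ) (x : ℕ → ℕ) (N : ℕ) : ℕ :=
  parseCost Q ((parseRest Q)^[N + 1] x) - g

/-- The ends of the successive runs of zeros. -/
noncomputable def parseEnd (Q : ℕ) (x : ℕ → ℕ) : ℕ → ℕ
  | 0 => parseTime Q x
  | N + 1 => parseEnd Q x N + parseTime Q ((parseRest Q)^[N + 1] x)

lemma parseRest_iterate (x : ℕ → ℕ) (N : ℕ) :
    (parseRest Q)^[N + 1] x = dropSeq (parseEnd Q x N) x := by
  induction N with
  | zero => rfl
  | succ N ih =>
    rw [Function.iterate_succ_apply', parseRest, parseEnd]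
    rw [ih]
    funext i
    simp only [dropSeq]
    congr 1
    ring

/-- Every iterate of the parser finds a run of zeros. -/
def ParseAll (Q : ℕ) (x : ℕ → ℕ) : Prop := ∀ N, ∃ n, ParseHits Q n (0, 0) ((parseRest Q)^[N] x)

lemma card_filter_Ico_eq_zero (x : ℕ → ℕ) (a n : ℕ) :
    {i ∈ Finset.Ico a (a + n) | x i = 0}.card = ∑ i ∈ Finset.range n, zeroInd (x (i + a)) := by
  rw [Finset.card_filter, Finset.sum_Ico_eq_sum_range, Nat.add_sub_cancel_left]
  exact Finset.sum_congr rfl fun i _ ↦ by simp [zeroInd, add_comm]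

lemma card_filter_Ico_ne_zero (x : ℕ → ℕ) (a n : ℕ) :
    {i ∈ Finset.Ico a (a + n) | x i ≠ 0}.card =
      ∑ i ∈ Finset.range n, (1 - zeroInd (x (i + a))) := by
  rw [Finset.card_filter, Finset.sum_Ico_eq_sum_range, Nat.add_sub_cancel_left]
  refine Finset.sum_congr rfl fun i _ ↦ ?_
  by_cases h : x (i + a) = 0 <;> simp [zeroInd, add_comm a, h]

/-- The cuts in the middle of the runs of zeros renormalize the environment. -/
lemma renormalizes_nextLabels {R g : ℕ} {x : ℕ → ℕ} (h : ParseAll (2 * R) x) :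
    Renormalizes R g x (fun N ↦ parseEnd (2 * R) x N - R) (nextLabels (2 * R) g x) := by
  set e := parseEnd (2 * R) x with he
  have hit : ∀ N, ParseHits (2 * R) (parseTime (2 * R) ((parseRest (2 * R))^[N] x)) (0, 0)
      ((parseRest (2 * R))^[N] x) := fun N ↦ parseHits_parseTime (h N)
  have hitS : ∀ N, ∃ τ, e (N + 1) = e N + τ ∧ ParseHits (2 * R) τ (0, 0) (dropSeq (e N) x) ∧
      nextLabels (2 * R) g x N = (parseState τ (0, 0) (dropSeq (e N) x)).2 - g := by
    intro N
    have := hit (N + 1)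
    refine ⟨parseTime (2 * R) ((parseRest (2 * R))^[N + 1] x), rfl, ?_, ?_⟩
    · rwa [← parseRest_iterate]
    · rw [nextLabels, parseCost, ← parseRest_iterate]
  have tail : ∀ {n : ℕ} {y : ℕ → ℕ}, ParseHits (2 * R) n (0, 0) y → 2 * R ≤ n ∧
      ∀ i < n, n ≤ i + 2 * R → y i = 0 := by
    intro n y hy
    have h1 := parseState_fst n (0, 0) y
    rw [hy.state] at h1
    exact ⟨by simpa using h1.1, h1.2⟩
  have first : ParseHits (2 * R) (e 0) (0, 0) x := hit 0
  have hrun : ∀ N, 2 * R ≤ e N ∧ ∀ n < e N, e N ≤ n + 2 * R → x n = 0 := by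
    intro N
    cases N with
    | zero => exact tail first
    | succ N =>
      obtain ⟨τ, h1, h2, -⟩ := hitS N
      obtain ⟨h3, h4⟩ := tail h2
      refine ⟨by omega, fun n hn hn' ↦ ?_⟩
      have := h4 (n - e N) (by omega) (by omega)
      rwa [dropSeq, Nat.sub_add_cancel (by omega)] at this
  have hlen : ∀ N, e N + 2 * R ≤ e (N + 1) := by
    intro N
    obtain ⟨τ, h1, h2, -⟩ := hitS N
    have := (tail h2).1
    omega
  have hIco : ∀ N, ∃ t, ParseHits (2 * R) (t + 2 * R) (0, 0) (dropSeq (e N) x) ∧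
      Finset.Ico (e N - R + R) (e (N + 1) - R - R) = Finset.Ico (e N) (e N + t) ∧
      (∀ i, t ≤ i → i < t + 2 * R → dropSeq (e N) x i = 0) ∧
      nextLabels (2 * R) g x N = (parseState (t + 2 * R) (0, 0) (dropSeq (e N) x)).2 - g := by
    intro N
    obtain ⟨τ, h1, h2, h5⟩ := hitS N
    obtain ⟨h3, h4⟩ := tail h2
    have h6 := (hrun N).1
    obtain ⟨t, rfl⟩ := Nat.exists_eq_add_of_le' h3
    refine ⟨t, h2, ?_, fun i hi hi' ↦ h4 i (by omega) (by omega), h5⟩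
    congr 1 <;> omega
  constructor
  · have := (hrun 0).1
    show R ≤ e 0 - R
    omega
  · intro N
    have := hlen N
    have := (hrun N).1
    show e N - R + 2 * R ≤ e (N + 1) - R
    omega
  · intro N n h1 h2
    have h3 := (hrun N).1
    exact (hrun N).2 n (by omega) (by omega)
  · intro N n h1 h2
    have h3 := (hrun (N + 1)).1
    exact (hrun (N + 1)).2 n (by omega) (by omega)
  · intro N
    obtain ⟨t, h1, h2, h3, h4⟩ := hIco N
    show _ = ∑ n ∈ Finset.Ico (e N - R + R) (e (N + 1) - R - R), cost (x n) - g
    -- The parsed piece extends the interior of the block by the final run of `2 * R` zeros, whose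
    -- cost is zero.
    rw [h2, h4, parseState_snd, zero_add, Finset.sum_range_add,
      Finset.sum_eq_zero (s := Finset.range (2 * R)), Finset.sum_Ico_eq_sum_range,
      Nat.add_sub_cancel_left, add_zero]
    · simp only [dropSeq, add_comm]
    · intro i hi
      rw [h3 (t + i) (by omega) (by rw [Finset.mem_range] at hi; omega)]
      rfl
  · intro N
    obtain ⟨t, h1, h2, h3, -⟩ := hIco N
    show {n ∈ Finset.Ico (e N - R + R) (e (N + 1) - R - R) | x n = 0}.card ≤
      2 * R * {n ∈ Finset.Ico (e N - R + R) (e (N + 1) - R - R) | x n ≠ 0}.card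
    rw [h2, card_filter_Ico_eq_zero, card_filter_Ico_ne_zero]
    have h4 := h1.zeros_le (by simp)
    rw [Finset.sum_range_add, Finset.sum_range_add] at h4
    have hz : ∀ i ∈ Finset.range (2 * R), dropSeq (e N) x (t + i) = 0 := fun i hi ↦
      h3 (t + i) (by omega) (by rw [Finset.mem_range] at hi; omega)
    have h5 : ∑ i ∈ Finset.range (2 * R), zeroInd (dropSeq (e N) x (t + i)) = 2 * R := by
      rw [Finset.sum_congr rfl (g := fun _ ↦ 1) fun i hi ↦ by rw [hz i hi]; rfl]
      simp
    have h6 : ∑ i ∈ Finset.range (2 * R), (1 - zeroInd (dropSeq (e N) x (t + i))) = 0 :=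
      Finset.sum_eq_zero fun i hi ↦ by rw [hz i hi]; rfl
    -- The `2 * R` zeros of the final run cancel the additive term of `ParseHits.zeros_le`.
    rw [h5, h6] at h4
    simp only [dropSeq, add_zero] at h4
    omega
  · intro h0
    have h1 : ParseHits (2 * R) (2 * R) (0, 0) x := parseHits_of_zeros (by simp) h0
    have : e 0 = 2 * R := first.unique h1
    show e 0 - R = R
    omega

end Parse

end OrientedPercolation

/-! ### The parser on a random sequence: renewal, moments and termination -/

namespace OrientedPercolation

open MeasureTheory ProbabilityTheory
open scoped ENNReal

section StreamLaw

/-- Two measures on sequences with the same values on boxes over initial segments. -/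
lemma eq_infinitePi_of_range {S : Type*} [MeasurableSpace S] {P : ℕ → Measure S}
    [∀ i, IsProbabilityMeasure (P i)] {ν : Measure (ℕ → S)}
    (h : ∀ (n : ℕ) (t : ℕ → Set S), (∀ i, MeasurableSet (t i)) →
      ν {x | ∀ i < n, x i ∈ t i} = ∏ i ∈ Finset.range n, P i (t i)) :
    ν = Measure.infinitePi P := by
  classical
  refine Measure.eq_infinitePi _ fun s t ht ↦ ?_
  obtain ⟨n, hn⟩ : ∃ n, s ⊆ Finset.range n := ⟨s.sup id + 1, fun i hi ↦ by
    rw [Finset.mem_range]; exact Nat.lt_succ_of_le (Finset.le_sup (f := id) hi)⟩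
  have := h n (fun i ↦ if i ∈ s then t i else Set.univ) fun i ↦ by
    split_ifs
    · exact ht i
    · exact MeasurableSet.univ
  have hset : {x : ℕ → S | ∀ i < n, x i ∈ if i ∈ s then t i else Set.univ} = Set.pi s t := by
    ext x
    simp only [Set.mem_ofPred_eq, Set.mem_pi, Finset.mem_coe]
    constructor
    · intro hx i hi
      simpa [hi] using hx i (Finset.mem_range.1 (hn hi))
    · intro hx i _
      split_ifs with hi
      · exact hx i hi
      · trivial
  rw [hset] at this
  rw [this, ← Finset.prod_subset hn (fun i _ hi ↦ by simp [hi])]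
  exact Finset.prod_congr rfl fun i hi ↦ by simp [hi]

/-- Put a term in front of a sequence. -/
def consSeq (p : ℕ × (ℕ → ℕ)) : ℕ → ℕ
  | 0 => p.1
  | n + 1 => p.2 n

lemma measurable_consSeq : Measurable consSeq := by
  refine measurable_pi_lambda _ fun n ↦ ?_
  cases n with
  | zero => exact measurable_fst
  | succ n => exact (measurable_pi_apply n).comp measurable_snd

variable (P : Measure ℕ) [IsProbabilityMeasure P]

/-- The law of a sequence of independent labels. -/
noncomputable abbrev streamLaw : Measure (ℕ → ℕ) := Measure.infinitePi fun _ : ℕ ↦ P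

/-- Conditioning on the first term: it turns every statement about the parser into an induction on
the number of terms read, without stopping times. -/
lemma map_consSeq : (P.prod (streamLaw P)).map consSeq = streamLaw P := by
  refine eq_infinitePi_of_range fun n t ht ↦ ?_
  have hm : MeasurableSet {x : ℕ → ℕ | ∀ i < n, x i ∈ t i} := by
    have : {x : ℕ → ℕ | ∀ i < n, x i ∈ t i} = ⋂ i ∈ Finset.range n, (fun x ↦ x i) ⁻¹' t i := by
      ext; simp
    rw [this]
    exact Finset.measurableSet_biInter _ fun i _ ↦ measurable_pi_apply i (ht i)
  rw [Measure.map_apply measurable_consSeq hm]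
  cases n with
  | zero => simp
  | succ n =>
    have : consSeq ⁻¹' {x | ∀ i < n + 1, x i ∈ t i} =
        t 0 ×ˢ Set.pi (Finset.range n) (fun i ↦ t (i + 1)) := by
      ext ⟨a, x⟩
      simp only [Set.mem_preimage, Set.mem_ofPred_eq, Set.mem_prod, Set.mem_pi, Finset.coe_range,
        Set.mem_Iio]
      constructor
      · intro h
        exact ⟨h 0 (by omega), fun i hi ↦ h (i + 1) (by omega)⟩
      · rintro ⟨h0, h⟩ i hi
        cases i with
        | zero => exact h0
        | succ i => exact h i (by omega)
    rw [this, Measure.prod_prod, Measure.infinitePi_pi _ (fun i _ ↦ ht (i + 1)),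
      Finset.prod_range_succ', mul_comm]

lemma lintegral_streamLaw {F : (ℕ → ℕ) → ℝ≥0∞} (hF : Measurable F) :
    ∫⁻ x, F x ∂streamLaw P = ∫⁻ a, ∫⁻ x, F (consSeq (a, x)) ∂streamLaw P ∂P := by
  conv_lhs => rw [← map_consSeq P]
  rw [lintegral_map hF measurable_consSeq]
  exact lintegral_prod _ (hF.comp measurable_consSeq).aemeasurable

lemma measurable_dropSeq (n : ℕ) : Measurable (dropSeq n) :=
  measurable_pi_lambda _ fun i ↦ measurable_pi_apply (i + n)

lemma measurable_comp_first {β : Type*} [MeasurableSpace β] {G : ℕ → (ℕ → ℕ) → β}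
    (hG : ∀ a, Measurable (G a)) : Measurable fun x : ℕ → ℕ ↦ G (x 0) (dropSeq 1 x) :=
  (measurable_from_prod_countable_right (f := fun p : ℕ × (ℕ → ℕ) ↦ G p.1 p.2) hG).comp
    ((measurable_pi_apply 0).prodMk (measurable_dropSeq 1))

lemma measurable_parseState (n : ℕ) (q : ℕ × ℕ) : Measurable (parseState n q) := by
  induction n generalizing q with
  | zero => exact measurable_const
  | succ n ih =>
    exact measurable_comp_first (G := fun a ↦ parseState n (parseStep q a)) (fun a ↦ ih _)

lemma measurableSet_parseHits (Q n : ℕ) (q : ℕ × ℕ) : MeasurableSet {x | ParseHits Q n q x} := by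
  rw [measurableSet_setOfPred]
  induction n generalizing q with
  | zero => exact measurable_const
  | succ n ih =>
    exact measurable_comp_first (G := fun a x ↦ q.1 ≠ Q ∧ ParseHits Q n (parseStep q a) x)
      (fun a ↦ measurable_const.and (ih _))

open Classical in
/-- The contribution of the event that the parser succeeds after `n` steps. -/
noncomputable def hitTerm (Q n : ℕ) (q : ℕ × ℕ) (f : ℕ → ℝ≥0∞) (g : (ℕ → ℕ) → ℝ≥0∞)
    (x : ℕ → ℕ) : ℝ≥0∞ :=
  if ParseHits Q n q x then f (parseState n q x).2 * g (dropSeq n x) else 0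

lemma measurable_hitTerm (Q n : ℕ) (q : ℕ × ℕ) (f : ℕ → ℝ≥0∞) {g : (ℕ → ℕ) → ℝ≥0∞}
    (hg : Measurable g) : Measurable (hitTerm Q n q f g) := by
  refine Measurable.ite (measurableSet_parseHits Q n q) ?_ measurable_const
  have hf : Measurable fun s : ℕ × ℕ ↦ f s.2 := Measurable.of_discrete
  exact (hf.comp (measurable_parseState n q)).mul (hg.comp (measurable_dropSeq n))

lemma hitTerm_succ {Q n : ℕ} {q : ℕ × ℕ} (hq : q.1 ≠ Q) (f : ℕ → ℝ≥0∞) (g : (ℕ → ℕ) → ℝ≥0∞)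
    (a : ℕ) (x : ℕ → ℕ) :
    hitTerm Q (n + 1) q f g (consSeq (a, x)) = hitTerm Q n (parseStep q a) f g x := by
  have h : ParseHits Q (n + 1) q (consSeq (a, x)) ↔ ParseHits Q n (parseStep q a) x :=
    and_iff_right hq
  by_cases hx : ParseHits Q n (parseStep q a) x
  · rw [hitTerm, hitTerm, if_pos hx, if_pos (h.2 hx)]
    rfl
  · rw [hitTerm, hitTerm, if_neg hx, if_neg (mt h.1 hx)]

lemma hitTerm_succ_of_eq {Q n : ℕ} {q : ℕ × ℕ} (hq : q.1 = Q) (f : ℕ → ℝ≥0∞)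
    (g : (ℕ → ℕ) → ℝ≥0∞) (x : ℕ → ℕ) : hitTerm Q (n + 1) q f g x = 0 :=
  if_neg fun h ↦ h.1 hq

lemma lintegral_hitTerm_succ {Q n : ℕ} {q : ℕ × ℕ} (hq : q.1 ≠ Q) (f : ℕ → ℝ≥0∞)
    {g : (ℕ → ℕ) → ℝ≥0∞} (hg : Measurable g) :
    ∫⁻ x, hitTerm Q (n + 1) q f g x ∂streamLaw P =
      ∫⁻ a, ∫⁻ x, hitTerm Q n (parseStep q a) f g x ∂streamLaw P ∂P := by
  rw [lintegral_streamLaw P (measurable_hitTerm Q _ q f hg)]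
  simp_rw [hitTerm_succ hq]

/-- The rest of the sequence is independent of the part that has been read. -/
lemma lintegral_hitTerm (Q n : ℕ) (q : ℕ × ℕ) (f : ℕ → ℝ≥0∞) {g : (ℕ → ℕ) → ℝ≥0∞}
    (hg : Measurable g) : ∫⁻ x, hitTerm Q n q f g x ∂streamLaw P =
      (∫⁻ x, hitTerm Q n q f 1 x ∂streamLaw P) * ∫⁻ x, g x ∂streamLaw P := by
  induction n generalizing q with
  | zero =>
    by_cases hq : q.1 = Q
    · have h1 : ∀ g, hitTerm Q 0 q f g = fun x ↦ f q.2 * g x := fun g ↦ by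
        funext x; exact if_pos hq
      rw [h1, h1, lintegral_const_mul _ hg]
      simp
    · have h1 : ∀ g, hitTerm Q 0 q f g = fun x ↦ 0 := fun g ↦ by
        funext x; exact if_neg hq
      rw [h1, h1]
      simp
  | succ n ih =>
    by_cases hq : q.1 = Q
    · simp_rw [hitTerm_succ_of_eq hq]
      simp
    · rw [lintegral_hitTerm_succ P hq f hg, lintegral_hitTerm_succ P hq f measurable_one]
      simp_rw [fun a ↦ ih (parseStep q a)]
      rw [lintegral_mul_const _ Measurable.of_discrete]

/-- The weight of the accumulated cost. -/
noncomputable def costWeight (l : ℕ) : ℝ≥0∞ := if l = 0 then 0 else 16 ^ l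

/-- A supermartingale that controls the accumulated cost of the parser. -/
noncomputable def parsePotential (β : ℝ≥0∞) (Q : ℕ) (q : ℕ × ℕ) : ℝ≥0∞ :=
  if q.2 = 0 then (Q - q.1 : ℕ) * β else 16 ^ q.2 * (1 + (Q - q.1 : ℕ) * β)

/-- A non-zero term `a` adds `a + 1` to the cost and resets the run. It multiplies the weight by `16
^ (a + 1)`, and `1 + Q * β ≤ 2` supplies the remaining factor `2`. -/
lemma parsePotential_parseStep_le {β : ℝ≥0∞} {Q : ℕ} (hβ : Q * β ≤ 1) (q : ℕ × ℕ) (a : ℕ) :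
    parsePotential β Q (parseStep q a) ≤
      parsePotential β Q (q.1 + 1, q.2) + 16 ^ q.2 * (2 * 16) * costWeight a := by
  by_cases ha : a = 0
  · simp [parseStep, ha]
  · have h1 : parseStep q a = (0, q.2 + (a + 1)) := by simp [parseStep, ha, cost]
    have h2 : 1 + (Q : ℝ≥0∞) * β ≤ 2 := by
      rw [← one_add_one_eq_two]; gcongr
    refine le_add_left ?_
    rw [h1, parsePotential, if_neg (by simp), costWeight, if_neg ha]
    simp only [Nat.sub_zero]
    calc (16 : ℝ≥0∞) ^ (q.2 + (a + 1)) * (1 + Q * β) ≤ 16 ^ (q.2 + (a + 1)) * 2 := by gcongr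
      _ = _ := by rw [pow_add, pow_succ]; ring

/-- Optional stopping for the supermartingale: lengthening the run by one lowers the potential by
`16 ^ q.2 * β`, which offsets the mean contribution of non-zero terms. When the run is complete, the
potential equals the weight of the cost. -/
lemma sum_lintegral_hitTerm_le {Q : ℕ} (hβ : Q * (32 * ∫⁻ a, costWeight a ∂P) ≤ 1) (m : ℕ)
    (q : ℕ × ℕ) (hq : q.1 ≤ Q) :
    ∑ n ∈ Finset.range m, ∫⁻ x, hitTerm Q n q costWeight 1 x ∂streamLaw P ≤
      parsePotential (32 * ∫⁻ a, costWeight a ∂P) Q q := by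
  set β := 32 * ∫⁻ a, costWeight a ∂P with hβd
  induction m generalizing q with
  | zero => simp
  | succ m ih =>
    rw [Finset.sum_range_succ']
    by_cases hqQ : q.1 = Q
    · have h1 : hitTerm Q 0 q costWeight 1 = fun _ ↦ costWeight q.2 := by
        funext x; exact (if_pos hqQ).trans (by simp [parseState])
      simp_rw [hitTerm_succ_of_eq hqQ, h1]
      simp only [lintegral_zero, Finset.sum_const_zero, zero_add, lintegral_const, measure_univ,
        mul_one]
      simp [parsePotential, costWeight, hqQ]
    · have h1 : hitTerm Q 0 q costWeight 1 = fun _ ↦ 0 := by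
        funext x; exact if_neg hqQ
      rw [h1]
      simp_rw [lintegral_hitTerm_succ P hqQ costWeight measurable_one]
      rw [lintegral_zero, add_zero, ← lintegral_finsetSum _ fun _ _ ↦ Measurable.of_discrete]
      have hstep : ∀ a, (parseStep q a).1 ≤ Q := fun a ↦ by
        unfold parseStep; split_ifs
        · show q.1 + 1 ≤ Q
          omega
        · exact Nat.zero_le _
      calc ∫⁻ a, ∑ n ∈ Finset.range m,
            ∫⁻ x, hitTerm Q n (parseStep q a) costWeight 1 x ∂streamLaw P ∂P
          ≤ ∫⁻ a, (parsePotential β Q (q.1 + 1, q.2) +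
              16 ^ q.2 * (2 * 16) * costWeight a) ∂P :=
            lintegral_mono fun a ↦ (ih _ (hstep a)).trans (parsePotential_parseStep_le hβ q a)
        _ = parsePotential β Q (q.1 + 1, q.2) + 16 ^ q.2 * β := by
            rw [lintegral_add_left measurable_const,
              lintegral_const_mul _ Measurable.of_discrete, hβd]
            simp only [lintegral_const, measure_univ, mul_one]
            ring_nf
        _ ≤ parsePotential β Q q := by
            have h2 : ((Q - q.1 : ℕ) : ℝ≥0∞) = (Q - (q.1 + 1) : ℕ) + 1 := by
              rw [← Nat.cast_succ]; congr 1; omega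
            unfold parsePotential
            simp only
            split_ifs with h0
            · rw [h2, h0, add_mul, one_mul, pow_zero, one_mul]
            · rw [h2]
              apply le_of_eq
              ring

open Classical in
/-- The probability that the parser has not succeeded before time `m`. -/
noncomputable def noHit (Q m : ℕ) (q : ℕ × ℕ) (x : ℕ → ℕ) : ℝ≥0∞ :=
  if ∃ n < m, ParseHits Q n q x then 0 else 1

lemma measurable_noHit (Q m : ℕ) (q : ℕ × ℕ) : Measurable (noHit Q m q) := by
  refine Measurable.ite ?_ measurable_const measurable_const
  have : {x | ∃ n < m, ParseHits Q n q x} = ⋃ n ∈ Finset.range m, {x | ParseHits Q n q x} := by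
    ext; simp
  rw [this]
  exact Finset.measurableSet_biUnion _ fun n _ ↦ measurableSet_parseHits Q n q

lemma noHit_succ {Q m : ℕ} {q : ℕ × ℕ} (hq : q.1 ≠ Q) (a : ℕ) (x : ℕ → ℕ) :
    noHit Q (m + 1) q (consSeq (a, x)) = noHit Q m (parseStep q a) x := by
  have : (∃ n < m + 1, ParseHits Q n q (consSeq (a, x))) ↔
      ∃ n < m, ParseHits Q n (parseStep q a) x := by
    constructor
    · rintro ⟨n, hn, h⟩
      cases n with
      | zero => exact absurd h hq
      | succ n => exact ⟨n, by omega, h.2⟩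
    · rintro ⟨n, hn, h⟩
      exact ⟨n + 1, by omega, hq, h⟩
  by_cases h : ∃ n < m, ParseHits Q n (parseStep q a) x
  · rw [noHit, noHit, if_pos h, if_pos (this.2 h)]
  · rw [noHit, noHit, if_neg h, if_neg (mt this.1 h)]

lemma noHit_succ_of_eq {Q m : ℕ} {q : ℕ × ℕ} (hq : q.1 = Q) (x : ℕ → ℕ) :
    noHit Q (m + 1) q x = 0 := if_pos ⟨0, by omega, hq⟩

/-- A drift argument: at each step before the hit, `2 * (2 * Q - q.1)` loses `2` on a zero, and
non-zero terms add at most `P {0}ᶜ * (4 * Q) ≤ 1` on average. So it decreases by at least one per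
step in the mean. -/
lemma mul_lintegral_noHit_le {Q : ℕ} (hP : P {0}ᶜ * (4 * Q) ≤ 1) (m : ℕ) (q : ℕ × ℕ)
    (hq : q.1 ≤ Q) :
    m * ∫⁻ x, noHit Q m q x ∂streamLaw P ≤ 2 * (2 * Q - q.1 : ℕ) := by
  induction m generalizing q with
  | zero => simp
  | succ m ih =>
    by_cases hqQ : q.1 = Q
    · simp_rw [noHit_succ_of_eq hqQ]
      simp
    · have h1 : ∀ a, ∫⁻ x, noHit Q m (parseStep q a) x ∂streamLaw P ≤ 1 := fun a ↦ by
        calc _ ≤ ∫⁻ x, 1 ∂streamLaw P := lintegral_mono fun x ↦ by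
              unfold noHit; split_ifs <;> simp
          _ = 1 := by simp
      have hstep : ∀ a, (parseStep q a).1 ≤ Q := fun a ↦ by
        unfold parseStep; split_ifs
        · show q.1 + 1 ≤ Q
          omega
        · exact Nat.zero_le _
      have h2 : ∀ a, (2 * (2 * Q - (parseStep q a).1 : ℕ) : ℝ≥0∞) ≤
          2 * (2 * Q - (q.1 + 1) : ℕ) + (4 * Q) * ({0}ᶜ : Set ℕ).indicator 1 a := fun a ↦ by
        by_cases ha : a = 0
        · simp [parseStep, ha]
        · refine le_add_left ?_
          simp only [parseStep, ha, if_false, Nat.sub_zero]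
          rw [Set.indicator_of_mem (by simpa using ha)]
          push_cast
          simp only [Pi.one_apply, mul_one]
          apply le_of_eq
          ring
      rw [lintegral_streamLaw P (measurable_noHit Q _ q)]
      simp_rw [noHit_succ hqQ]
      rw [← lintegral_const_mul _ Measurable.of_discrete]
      calc ∫⁻ a, ((m + 1 : ℕ) : ℝ≥0∞) * ∫⁻ x, noHit Q m (parseStep q a) x ∂streamLaw P ∂P
          ≤ ∫⁻ a, (2 * (2 * Q - (q.1 + 1) : ℕ) + (4 * Q) * ({0}ᶜ : Set ℕ).indicator 1 a + 1) ∂P :=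
            lintegral_mono fun a ↦ by
              rw [Nat.cast_succ, add_mul, one_mul]
              exact add_le_add ((ih _ (hstep a)).trans (h2 a)) (h1 a)
        _ = 2 * (2 * Q - (q.1 + 1) : ℕ) + P {0}ᶜ * (4 * Q) + 1 := by
            rw [lintegral_add_right _ measurable_const, lintegral_add_left measurable_const,
              lintegral_const_mul (4 * (Q : ℝ≥0∞)) (f := ({0}ᶜ : Set ℕ).indicator 1)
                Measurable.of_discrete,
              lintegral_indicator_one (MeasurableSet.of_discrete)]
            simp only [lintegral_const, measure_univ, mul_one]
            ring
        _ ≤ 2 * (2 * Q - (q.1 + 1) : ℕ) + 1 + 1 := by gcongr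
        _ = 2 * (2 * Q - q.1 : ℕ) := by
            have h3 : ((2 * Q - q.1 : ℕ) : ℝ≥0∞) = (2 * Q - (q.1 + 1) : ℕ) + 1 := by
              rw [← Nat.cast_succ]; congr 1; omega
            rw [h3]
            ring

/-- The parser almost surely finds a run of zeros. -/
lemma ae_exists_parseHits {Q : ℕ} (hP : P {0}ᶜ * (4 * Q) ≤ 1) :
    ∀ᵐ x ∂streamLaw P, ∃ n, ParseHits Q n (0, 0) x := by
  rw [ae_iff]
  by_contra hne
  -- A positive probability of never succeeding would make `m` times it unbounded, against the drift
  -- estimate.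
  obtain ⟨m, hm⟩ := ENNReal.exists_nat_mul_gt hne (b := 2 * (2 * Q - 0 : ℕ))
    (ENNReal.mul_ne_top (by simp) (ENNReal.natCast_ne_top _))
  refine absurd (mul_lintegral_noHit_le P hP m (0, 0) (Nat.zero_le _)) (not_le.2 (hm.trans_le ?_))
  gcongr
  rw [← lintegral_indicator_one₀]
  · refine lintegral_mono fun x ↦ ?_
    by_cases hx : ∃ n, ParseHits Q n (0, 0) x
    · simp [hx]
    · have : ¬ ∃ n < m, ParseHits Q n (0, 0) x := fun ⟨n, _, h⟩ ↦ hx ⟨n, h⟩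
      rw [noHit, if_neg this]
      exact Set.indicator_le_self' (fun _ _ ↦ zero_le_one) x
  · have : {x | ¬ ∃ n, ParseHits Q n (0, 0) x} = (⋃ n, {x | ParseHits Q n (0, 0) x})ᶜ := by
      ext; simp
    rw [this]
    exact (MeasurableSet.iUnion fun n ↦ measurableSet_parseHits Q n _).compl.nullMeasurableSet

end StreamLaw

end OrientedPercolation

/-! ### The law of the renormalized labels -/

namespace OrientedPercolation

open MeasureTheory ProbabilityTheory
open scoped ENNReal

section NextLaw

variable {Q : ℕ}

lemma measurable_parseTime : Measurable (parseTime Q) := by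
  classical
  refine measurable_to_countable' fun n ↦ ?_
  have hne : MeasurableSet {x | ¬ ∃ n, ParseHits Q n (0, 0) x} := by
    have : {x | ¬ ∃ n, ParseHits Q n (0, 0) x} = (⋃ n, {x | ParseHits Q n (0, 0) x})ᶜ := by
      ext; simp
    rw [this]
    exact (MeasurableSet.iUnion fun n ↦ measurableSet_parseHits Q n _).compl
  have : parseTime Q ⁻¹' {n} = {x | ParseHits Q n (0, 0) x} ∪
      (if n = 0 then {x | ¬ ∃ n, ParseHits Q n (0, 0) x} else ∅) := by
    ext x
    by_cases hx : ∃ n, ParseHits Q n (0, 0) x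
    · have h1 := parseHits_parseTime hx
      have : (x ∈ if n = 0 then {x | ¬ ∃ n, ParseHits Q n (0, 0) x} else ∅) ↔ False := by
        split_ifs <;> simp [hx]
      simp only [Set.mem_preimage, Set.mem_singleton_iff, Set.mem_union, this, or_false]
      exact ⟨fun h ↦ h ▸ h1, fun h ↦ h1.unique h⟩
    · have h1 : parseTime Q x = 0 := by rw [parseTime, dif_neg hx]
      have h2 : ¬ ParseHits Q n (0, 0) x := fun h ↦ hx ⟨n, h⟩
      simp only [Set.mem_preimage, Set.mem_singleton_iff, Set.mem_union, h1]
      split_ifs with h0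
      · simpa [h0] using Or.inr (by simpa using hx)
      · simpa [eq_comm, h0] using h2
  rw [this]
  refine (measurableSet_parseHits Q n _).union ?_
  split_ifs
  · exact hne
  · exact MeasurableSet.empty

lemma measurable_parseCost : Measurable (parseCost Q) :=
  (measurable_from_prod_countable_right
    (f := fun p : ℕ × (ℕ → ℕ) ↦ (parseState p.1 (0, 0) p.2).2)
    fun n ↦ measurable_snd.comp (measurable_parseState n (0, 0))).comp
    (measurable_parseTime.prodMk measurable_id)

lemma measurable_parseRest : Measurable (parseRest Q) :=
  (measurable_from_prod_countable_right (f := fun p : ℕ × (ℕ → ℕ) ↦ dropSeq p.1 p.2)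
    fun n ↦ measurable_dropSeq n).comp (measurable_parseTime.prodMk measurable_id)

lemma measurable_nextLabels (Q g : ℕ) : Measurable (nextLabels Q g) :=
  measurable_pi_lambda _ fun N ↦
    (Measurable.of_discrete (f := fun l : ℕ ↦ l - g)).comp
      (measurable_parseCost.comp (measurable_parseRest.iterate (N + 1)))

lemma tsum_hitTerm {x : ℕ → ℕ} (hx : ∃ n, ParseHits Q n (0, 0) x) (f : ℕ → ℝ≥0∞)
    (g : (ℕ → ℕ) → ℝ≥0∞) :
    ∑' n, hitTerm Q n (0, 0) f g x = f (parseCost Q x) * g (parseRest Q x) := by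
  have h1 := parseHits_parseTime hx
  rw [tsum_eq_single (parseTime Q x)]
  · exact if_pos h1
  · intro n hn
    exact if_neg fun h ↦ hn (h.unique h1)

variable {P : Measure ℕ}

lemma lintegral_parseCost_mul_eq_tsum (hfin : ∀ᵐ x ∂streamLaw P, ∃ n, ParseHits Q n (0, 0) x)
    (f : ℕ → ℝ≥0∞) {g : (ℕ → ℕ) → ℝ≥0∞} (hg : Measurable g) :
    ∫⁻ x, f (parseCost Q x) * g (parseRest Q x) ∂streamLaw P =
      ∑' n, ∫⁻ x, hitTerm Q n (0, 0) f g x ∂streamLaw P := by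
  rw [← lintegral_tsum fun n ↦ (measurable_hitTerm Q n _ f hg).aemeasurable]
  refine lintegral_congr_ae ?_
  filter_upwards [hfin] with x hx
  rw [tsum_hitTerm hx]

lemma lintegral_parseCost_eq_tsum (hfin : ∀ᵐ x ∂streamLaw P, ∃ n, ParseHits Q n (0, 0) x)
    (f : ℕ → ℝ≥0∞) : ∫⁻ x, f (parseCost Q x) ∂streamLaw P =
      ∑' n, ∫⁻ x, hitTerm Q n (0, 0) f 1 x ∂streamLaw P := by
  rw [← lintegral_parseCost_mul_eq_tsum hfin f measurable_one]
  simp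

variable [IsProbabilityMeasure P]

lemma lintegral_parseCost_mul (hfin : ∀ᵐ x ∂streamLaw P, ∃ n, ParseHits Q n (0, 0) x)
    (f : ℕ → ℝ≥0∞) {g : (ℕ → ℕ) → ℝ≥0∞} (hg : Measurable g) :
    ∫⁻ x, f (parseCost Q x) * g (parseRest Q x) ∂streamLaw P =
      (∫⁻ x, f (parseCost Q x) ∂streamLaw P) * ∫⁻ x, g x ∂streamLaw P := by
  rw [lintegral_parseCost_mul_eq_tsum hfin f hg, lintegral_parseCost_eq_tsum hfin,
    ← ENNReal.tsum_mul_right]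
  exact tsum_congr fun n ↦ lintegral_hitTerm P Q n _ f hg

/-- The renewal property, obtained by summing `lintegral_hitTerm` over the possible lengths of the
first piece. -/
lemma measure_parseCost_inter (hfin : ∀ᵐ x ∂streamLaw P, ∃ n, ParseHits Q n (0, 0) x)
    (B : Set ℕ) {D : Set (ℕ → ℕ)} (hD : MeasurableSet D) :
    streamLaw P {x | parseCost Q x ∈ B ∧ parseRest Q x ∈ D} =
      streamLaw P {x | parseCost Q x ∈ B} * streamLaw P D := by
  have h := lintegral_parseCost_mul hfin (B.indicator 1) (g := D.indicator 1)
    (measurable_one.indicator hD)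
  have hB : MeasurableSet {x | parseCost Q x ∈ B} :=
    measurable_parseCost (MeasurableSet.of_discrete (s := B))
  have hBD : MeasurableSet {x | parseCost Q x ∈ B ∧ parseRest Q x ∈ D} :=
    hB.inter (measurable_parseRest hD)
  rw [lintegral_indicator_one hD] at h
  rw [← lintegral_indicator_one hBD, ← lintegral_indicator_one hB]
  calc _ = ∫⁻ x, B.indicator 1 (parseCost Q x) * D.indicator 1 (parseRest Q x) ∂streamLaw P := by
        refine lintegral_congr fun x ↦ ?_
        by_cases h1 : parseCost Q x ∈ B <;> by_cases h2 : parseRest Q x ∈ D <;>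
          simp [Set.indicator, h1, h2]
    _ = _ := h

lemma map_parseRest (hfin : ∀ᵐ x ∂streamLaw P, ∃ n, ParseHits Q n (0, 0) x) :
    (streamLaw P).map (parseRest Q) = streamLaw P := by
  ext D hD
  have := measure_parseCost_inter hfin Set.univ hD
  rw [Measure.map_apply measurable_parseRest hD]
  simpa [Set.preimage] using this

variable (P) in
/-- The law of the labels of the renormalized environment. -/
noncomputable def nextLaw (Q g : ℕ) : Measure ℕ :=
  (streamLaw P).map fun x ↦ parseCost Q x - g

lemma measurable_parseCost_sub (g : ℕ) : Measurable fun x ↦ parseCost Q x - g :=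
  (Measurable.of_discrete (f := fun l : ℕ ↦ l - g)).comp measurable_parseCost

instance (Q g : ℕ) : IsProbabilityMeasure (nextLaw P Q g) :=
  Measure.isProbabilityMeasure_map (measurable_parseCost_sub g).aemeasurable

/-- The labels of the renormalized environment are independent and identically distributed. -/
lemma map_nextLabels (hfin : ∀ᵐ x ∂streamLaw P, ∃ n, ParseHits Q n (0, 0) x) (g : ℕ) :
    (streamLaw P).map (nextLabels Q g) = streamLaw (nextLaw P Q g) := by
  have hy : Measurable fun (x : ℕ → ℕ) (N : ℕ) ↦ parseCost Q ((parseRest Q)^[N] x) - g :=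
    measurable_pi_lambda _ fun N ↦ (measurable_parseCost_sub g).comp (measurable_parseRest.iterate N)
  have hcomp : nextLabels Q g =
      (fun (x : ℕ → ℕ) (N : ℕ) ↦ parseCost Q ((parseRest Q)^[N] x) - g) ∘ parseRest Q := rfl
  -- The piece before the first cut is discarded, since it has no good stretch guaranteed on its
  -- left. This leaves the law of the sequence unchanged.
  rw [hcomp, ← Measure.map_map hy measurable_parseRest, map_parseRest hfin]
  refine eq_infinitePi_of_range fun n t ht ↦ ?_
  have hm : ∀ (n : ℕ) (t : ℕ → Set ℕ), MeasurableSet {x : ℕ → ℕ | ∀ i < n, x i ∈ t i} := by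
    intro n t
    have : {x : ℕ → ℕ | ∀ i < n, x i ∈ t i} = ⋂ i ∈ Finset.range n, (fun x ↦ x i) ⁻¹' t i := by
      ext; simp
    rw [this]
    exact Finset.measurableSet_biInter _ fun i _ ↦
      measurable_pi_apply i (MeasurableSet.of_discrete (s := t i))
  rw [Measure.map_apply hy (hm n t)]
  induction n generalizing t with
  | zero => simp
  | succ n ih =>
    have hset : (fun (x : ℕ → ℕ) (N : ℕ) ↦ parseCost Q ((parseRest Q)^[N] x) - g) ⁻¹'
        {x | ∀ i < n + 1, x i ∈ t i} =
        {x | parseCost Q x ∈ (fun l ↦ l - g) ⁻¹' t 0 ∧ parseRest Q x ∈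
          (fun (x : ℕ → ℕ) (N : ℕ) ↦ parseCost Q ((parseRest Q)^[N] x) - g) ⁻¹'
            {x | ∀ i < n, x i ∈ t (i + 1)}} := by
      ext x
      simp only [Set.mem_preimage, Set.mem_ofPred_eq]
      constructor
      · intro h
        exact ⟨h 0 (by omega), fun i hi ↦ h (i + 1) (by omega)⟩
      · rintro ⟨h0, h⟩ i hi
        cases i with
        | zero => exact h0
        | succ i => exact h i (by omega)
    rw [hset, measure_parseCost_inter hfin _ (hy (hm n fun i ↦ t (i + 1))),
      ih (fun i ↦ t (i + 1)) (fun i ↦ ht _), Finset.prod_range_succ', mul_comm]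
    congr 1
    rw [nextLaw, Measure.map_apply (measurable_parseCost_sub g) (ht 0)]
    rfl

lemma costWeight_sub_mul_le (l g : ℕ) : costWeight (l - g) * 16 ^ g ≤ costWeight l := by
  unfold costWeight
  by_cases h : l ≤ g
  · simp [Nat.sub_eq_zero_of_le h]
  · rw [if_neg (by omega), if_neg (by omega), ← pow_add, Nat.sub_add_cancel (by omega)]

/-- Lowering the cost by `g` divides its weight by at least `16 ^ g`, and the potential of the
initial state `(0, 0)` is `Q * β`. -/
lemma lintegral_costWeight_nextLaw_mul_le
    (hfin : ∀ᵐ x ∂streamLaw P, ∃ n, ParseHits Q n (0, 0) x)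
    (hβ : Q * (32 * ∫⁻ a, costWeight a ∂P) ≤ 1) (g : ℕ) :
    (∫⁻ a, costWeight a ∂nextLaw P Q g) * 16 ^ g ≤ Q * (32 * ∫⁻ a, costWeight a ∂P) := by
  rw [nextLaw, lintegral_map Measurable.of_discrete (measurable_parseCost_sub g),
    ← lintegral_mul_const (f := fun x ↦ costWeight (parseCost Q x - g)) _
      ((Measurable.of_discrete (f := costWeight)).comp (measurable_parseCost_sub g))]
  calc _ ≤ ∫⁻ x, costWeight (parseCost Q x) ∂streamLaw P :=
        lintegral_mono fun x ↦ costWeight_sub_mul_le _ _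
    _ = ∑' n, ∫⁻ x, hitTerm Q n (0, 0) costWeight 1 x ∂streamLaw P :=
        lintegral_parseCost_eq_tsum hfin _
    _ ≤ parsePotential (32 * ∫⁻ a, costWeight a ∂P) Q (0, 0) :=
        ENNReal.tsum_le_of_sum_range_le fun m ↦
          sum_lintegral_hitTerm_le P hβ m (0, 0) (Nat.zero_le _)
    _ = _ := by simp [parsePotential]

lemma measure_compl_zero_le (P : Measure ℕ) : P {0}ᶜ ≤ ∫⁻ a, costWeight a ∂P := by
  rw [← lintegral_indicator_one (MeasurableSet.of_discrete)]
  refine lintegral_mono fun a ↦ ?_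
  by_cases ha : a = 0
  · simp [ha]
  · rw [Set.indicator_of_mem (by simpa using ha), costWeight, if_neg ha]
    exact one_le_pow₀ (by norm_num)

end NextLaw

/-! ### The environment at all levels -/

section Levels

/-- The labels of the columns at all levels. -/
noncomputable def levelLabels : ℕ → (ℕ → ℕ) → ℕ → ℕ
  | 0, x => x
  | k + 1, x => nextLabels (2 * runLength k) (gain k) (levelLabels k x)

/-- The cuts of the columns of level `k`. -/
noncomputable def levelCut (k : ℕ) (x : ℕ → ℕ) (N : ℕ) : ℕ :=
  parseEnd (2 * runLength k) (levelLabels k x) N - runLength k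

lemma measurable_levelLabels (k : ℕ) : Measurable (levelLabels k) := by
  induction k with
  | zero => exact measurable_id
  | succ k ih => exact (measurable_nextLabels _ _).comp ih

/-- The bound for the exponential moment of the labels of level `k`. -/
noncomputable def momentBound (k : ℕ) : ℝ≥0∞ := (2⁻¹) ^ (40 + 3 * k)

lemma two_pow_mul_inv_two_pow (a b : ℕ) : (2 : ℝ≥0∞) ^ a * 2⁻¹ ^ (a + b) = 2⁻¹ ^ b := by
  rw [pow_add, ← mul_assoc, ← mul_pow, ENNReal.mul_inv_cancel (by norm_num) (by norm_num),
    one_pow, one_mul]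

lemma runLength_mul_momentBound (k : ℕ) :
    ((2 * runLength k : ℕ) : ℝ≥0∞) * (32 * momentBound k) = 2⁻¹ ^ (7 + k) := by
  have h : ((2 * runLength k : ℕ) : ℝ≥0∞) * (32 * momentBound k) =
      2 ^ (33 + 2 * k) * 2⁻¹ ^ ((33 + 2 * k) + (7 + k)) := by
    unfold momentBound runLength
    rw [show 40 + 3 * k = (33 + 2 * k) + (7 + k) by ring, ← mul_assoc]
    congr 1
    push_cast
    rw [pow_add, pow_add]
    ring_nf
  rw [h, two_pow_mul_inv_two_pow]

/-- The gain pays for the long runs: `16 ^ gain k = 2 ^ (4 * k + 36)`, and `(7 + k) + (4 * k + 36) ≥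
43 + 3 * k`, with equality at `k = 0`. -/
lemma momentBound_succ (k : ℕ) : 2⁻¹ ^ (7 + k) ≤ momentBound (k + 1) * 16 ^ gain k := by
  have h : momentBound (k + 1) * 16 ^ gain k =
      2 ^ (36 + 3 * k) * 2⁻¹ ^ ((36 + 3 * k) + 7) * 2 ^ k := by
    unfold momentBound gain
    have h1 : (16 : ℝ≥0∞) ^ (k + 9) = 2 ^ (36 + 3 * k) * 2 ^ k := by
      rw [show (16 : ℝ≥0∞) = 2 ^ 4 by norm_num, ← pow_mul, ← pow_add]
      congr 1
      ring
    rw [h1, show 40 + 3 * (k + 1) = 36 + 3 * k + 7 by ring]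
    ring
  rw [h, two_pow_mul_inv_two_pow]
  calc (2⁻¹ : ℝ≥0∞) ^ (7 + k) ≤ 2⁻¹ ^ 7 :=
        pow_le_pow_of_le_one zero_le (ENNReal.inv_le_one.2 (by norm_num)) (by omega)
    _ ≤ 2⁻¹ ^ 7 * 2 ^ k := le_mul_of_one_le_right zero_le (one_le_pow₀ (by norm_num))

lemma parse_hypotheses {P : Measure ℕ} {k : ℕ} (hb : ∫⁻ a, costWeight a ∂P ≤ momentBound k) :
    ((2 * runLength k : ℕ) : ℝ≥0∞) * (32 * ∫⁻ a, costWeight a ∂P) ≤ 2⁻¹ ^ (7 + k) ∧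
      P {0}ᶜ * (4 * (2 * runLength k : ℕ)) ≤ 1 := by
  have h1 : ((2 * runLength k : ℕ) : ℝ≥0∞) * (32 * ∫⁻ a, costWeight a ∂P) ≤ 2⁻¹ ^ (7 + k) := by
    rw [← runLength_mul_momentBound]
    gcongr
  refine ⟨h1, ?_⟩
  calc P {0}ᶜ * (4 * (2 * runLength k : ℕ))
      ≤ (∫⁻ a, costWeight a ∂P) * (32 * (2 * runLength k : ℕ)) := by
        gcongr
        · exact measure_compl_zero_le P
        · norm_num
    _ = ((2 * runLength k : ℕ) : ℝ≥0∞) * (32 * ∫⁻ a, costWeight a ∂P) := by ring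
    _ ≤ 2⁻¹ ^ (7 + k) := h1
    _ ≤ 1 := pow_le_one₀ zero_le (ENNReal.inv_le_one.2 (by norm_num))

variable {P₀ : Measure ℕ} [IsProbabilityMeasure P₀]

/-- The labels of level `k` are independent and identically distributed, and their exponential
moments decay geometrically in `k`. -/
lemma exists_levelLaw (h₀ : ∫⁻ a, costWeight a ∂P₀ ≤ momentBound 0) (k : ℕ) :
    ∃ P : Measure ℕ, ∃ _ : IsProbabilityMeasure P,
      (streamLaw P₀).map (levelLabels k) = streamLaw P ∧ ∫⁻ a, costWeight a ∂P ≤ momentBound k := by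
  induction k with
  | zero => exact ⟨P₀, inferInstance, Measure.map_id, h₀⟩
  | succ k ih =>
    obtain ⟨P, hP, hmap, hb⟩ := ih
    obtain ⟨h1, h2⟩ := parse_hypotheses hb
    have hfin := ae_exists_parseHits P h2
    refine ⟨nextLaw P (2 * runLength k) (gain k), inferInstance, ?_, ?_⟩
    · rw [← map_nextLabels hfin, ← hmap, Measure.map_map (measurable_nextLabels _ _)
        (measurable_levelLabels k)]
      rfl
    · have h3 := lintegral_costWeight_nextLaw_mul_le hfin
        (h1.trans (pow_le_one₀ zero_le (ENNReal.inv_le_one.2 (by norm_num)))) (gain k)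
      have h4 := (h3.trans h1).trans (momentBound_succ k)
      exact (ENNReal.mul_le_mul_iff_left (by positivity) (by simp)).1 h4

lemma ae_parseAll {P : Measure ℕ} [IsProbabilityMeasure P] {Q : ℕ}
    (hfin : ∀ᵐ x ∂streamLaw P, ∃ n, ParseHits Q n (0, 0) x) :
    ∀ᵐ x ∂streamLaw P, ParseAll Q x := by
  have hmp : MeasurePreserving (parseRest Q) (streamLaw P) (streamLaw P) :=
    ⟨measurable_parseRest, map_parseRest hfin⟩
  exact ae_all_iff.2 fun N ↦ (hmp.iterate N).quasiMeasurePreserving.ae hfin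

/-- Almost every environment is renormalizable at all levels, and the first columns of every
sufficiently high level are good. -/
lemma ae_levels (h₀ : ∫⁻ a, costWeight a ∂P₀ ≤ momentBound 0) :
    ∀ᵐ x ∂streamLaw P₀, (∀ k, Renormalizes (runLength k) (gain k) (levelLabels k x)
      (levelCut k x) (levelLabels (k + 1) x)) ∧
      ∀ᶠ k in Filter.atTop, ∀ n < 2 * runLength k, levelLabels k x n = 0 := by
  refine Filter.Eventually.and (ae_all_iff.2 fun k ↦ ?_) ?_
  · obtain ⟨P, hP, hmap, hb⟩ := exists_levelLaw h₀ k
    have h1 := ae_parseAll (ae_exists_parseHits P (parse_hypotheses hb).2)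
    rw [← hmap] at h1
    filter_upwards [ae_of_ae_map (measurable_levelLabels k).aemeasurable h1] with x hx
    exact renormalizes_nextLabels hx
  -- A union bound over the first columns gives a summable series, and Borel–Cantelli applies.
  · have hle : ∀ k, streamLaw P₀ {x | ∃ n < 2 * runLength k, levelLabels k x n ≠ 0} ≤
        2⁻¹ ^ (7 + k) := by
      intro k
      obtain ⟨P, hP, hmap, hb⟩ := exists_levelLaw h₀ k
      have hset : {x | ∃ n < 2 * runLength k, levelLabels k x n ≠ 0} ⊆
          levelLabels k ⁻¹' ⋃ n ∈ Finset.range (2 * runLength k), {y | y n ∈ ({0}ᶜ : Set ℕ)} := by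
        rintro x ⟨n, hn, hx⟩
        simp only [Set.mem_preimage, Set.mem_iUnion, Finset.mem_range]
        exact ⟨n, hn, hx⟩
      have hm : ∀ n, MeasurableSet {y : ℕ → ℕ | y n ∈ ({0}ᶜ : Set ℕ)} := fun n ↦
        measurable_pi_apply n (MeasurableSet.of_discrete (s := ({0}ᶜ : Set ℕ)))
      have hPn : ∀ n, streamLaw P {y : ℕ → ℕ | y n ∈ ({0}ᶜ : Set ℕ)} = P {0}ᶜ := fun n ↦
        (measurePreserving_eval_infinitePi (fun _ : ℕ ↦ P) n).measure_preimage
          (MeasurableSet.of_discrete (s := ({0}ᶜ : Set ℕ))).nullMeasurableSet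
      calc _ ≤ _ := measure_mono hset
        _ = streamLaw P (⋃ n ∈ Finset.range (2 * runLength k), {y | y n ∈ ({0}ᶜ : Set ℕ)}) := by
            rw [← hmap, Measure.map_apply (measurable_levelLabels k)]
            exact Finset.measurableSet_biUnion _ fun n _ ↦ hm n
        _ ≤ ∑ n ∈ Finset.range (2 * runLength k), streamLaw P {y | y n ∈ ({0}ᶜ : Set ℕ)} :=
            measure_biUnion_finset_le _ _
        _ = (2 * runLength k : ℕ) * P {0}ᶜ := by
            simp_rw [hPn]
            rw [Finset.sum_const, Finset.card_range, nsmul_eq_mul]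
        _ ≤ (2 * runLength k : ℕ) * (32 * ∫⁻ a, costWeight a ∂P) := by
            gcongr
            exact (measure_compl_zero_le P).trans
              (le_mul_of_one_le_left zero_le (by norm_num))
        _ ≤ _ := (parse_hypotheses hb).1
    have hsum : ∑' k, streamLaw P₀ {x | ∃ n < 2 * runLength k, levelLabels k x n ≠ 0} ≠ ∞ := by
      refine ne_top_of_le_ne_top ?_ (ENNReal.tsum_le_tsum hle)
      simp_rw [pow_add]
      rw [ENNReal.tsum_mul_left, ENNReal.tsum_geometric]
      refine ENNReal.mul_ne_top (by simp) ?_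
      simp
    filter_upwards [ae_eventually_notMem hsum] with x hx
    filter_upwards [hx] with k hk n hn
    by_contra h
    exact hk ⟨n, hn, h⟩

end Levels

end OrientedPercolation

/-! ### Propagation through the levels and survival of the origin -/

namespace OrientedPercolation

open MeasureTheory ProbabilityTheory MeasurableSpace

section Time

/-- The level-zero time at which the `n`-th column of level `k` starts. -/
def levelTime (c : ℕ → ℕ → ℕ) : ℕ → ℕ → ℕ
  | 0, n => n
  | k + 1, n => levelTime c k (c k n)

/-- The number of level-zero lanes in a lane of level `k`. -/
noncomputable def laneWidth : ℕ → ℕ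
  | 0 => 1
  | k + 1 => width k * laneWidth k

lemma laneWidth_pos (k : ℕ) : 0 < laneWidth k := by
  induction k with
  | zero => exact one_pos
  | succ k ih => exact Nat.mul_pos (by have := ten_le_width k; omega) ih

variable {v c : ℕ → ℕ → ℕ}

/-- Columns last at least as long as lanes are wide, because the cuts are `2 * runLength k ≥ width
k` apart. This lets the light cone of the origin cover a lane of a high level. -/
lemma levelTime_add_le (hr : ∀ k, Renormalizes (runLength k) (gain k) (v k) (c k) (v (k + 1)))
    (k n j : ℕ) : levelTime c k n + j * laneWidth k ≤ levelTime c k (n + j) := by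
  induction k generalizing n j with
  | zero => simp [levelTime, laneWidth]
  | succ k ih =>
    induction j with
    | zero => simp
    | succ j ihj =>
      have hlen := (hr k).length (n + j)
      have hW := two_mul_width_add_four_le k
      have h1 := ih (c k (n + j)) (c k (n + j + 1) - c k (n + j))
      rw [Nat.add_sub_cancel' (by omega)] at h1
      have h2 : width k * laneWidth k ≤ (c k (n + j + 1) - c k (n + j)) * laneWidth k :=
        Nat.mul_le_mul_right _ (by omega)
      simp only [levelTime, laneWidth] at ihj ⊢
      rw [Nat.succ_mul, ← Nat.add_assoc n j 1]
      omega

lemma levelTime_mono (hr : ∀ k, Renormalizes (runLength k) (gain k) (v k) (c k) (v (k + 1)))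
    (k : ℕ) : Monotone (levelTime c k) := by
  intro n m h
  have := levelTime_add_le hr k n (m - n)
  rw [Nat.add_sub_cancel' h] at this
  omega

lemma laneWidth_le_levelTime
    (hr : ∀ k, Renormalizes (runLength k) (gain k) (v k) (c k) (v (k + 1))) (k : ℕ) :
    levelTime c k 0 + laneWidth (k + 1) ≤ levelTime c (k + 1) 0 := by
  have h1 := levelTime_add_le hr k 0 (c k 0)
  have h2 : width k * laneWidth k ≤ c k 0 * laneWidth k :=
    Nat.mul_le_mul_right _ (by have := (hr k).le_first; have := two_mul_width_add_four_le k; omega)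
  rw [zero_add] at h1
  simp only [levelTime, laneWidth] at *
  omega

lemma le_levelTime (hr : ∀ k, Renormalizes (runLength k) (gain k) (v k) (c k) (v (k + 1)))
    (k : ℕ) : k ≤ levelTime c k 0 := by
  induction k with
  | zero => exact Nat.zero_le _
  | succ k ih =>
    have := laneWidth_le_levelTime hr k
    have := laneWidth_pos (k + 1)
    omega

end Time

section Alive

variable {v c : ℕ → ℕ → ℕ}

/-- The lane `x` of level `k` is alive at the beginning of the column `n` of level `k`, if `A` is
the set of the level-zero lanes that are reached at that time. -/
def Alive (c : ℕ → ℕ → ℕ) : ℕ → ℕ → Set ℤ → ℤ → Prop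
  | 0, _, A, x => x ∈ A
  | k + 1, N, A, X =>
    FullOn (Alive c k (c k N) A) (c k N) (X * width k - 6) (X * width k - 2) ∨
      FullOn (Alive c k (c k N) A) (c k N) (X * width k + 2) (X * width k + 6)

lemma Alive.nonempty {k n : ℕ} {A : Set ℤ} {x : ℤ} (h : Alive c k n A x) : A.Nonempty := by
  induction k generalizing n x with
  | zero => exact ⟨x, h⟩
  | succ k ih =>
    have key : ∀ (m : ℕ) (α : ℤ), FullOn (Alive c k m A) m α (α + 4) → A.Nonempty := by
      intro m α hf
      exact ih (hf (α + ((m : ℤ) + α) % 2) (by omega) (by omega) (by rw [Int.even_iff]; omega))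
    rcases h with h | h
    · exact key _ _ (h.mono le_rfl (by omega))
    · exact key _ _ (h.mono le_rfl (by omega))

/-- The windows lie within `6` lanes of the centre, so at every level they stay, with a margin,
inside a neighbourhood of radius one lane of the next level. -/
lemma alive_of_cover {k n : ℕ} {A : Set ℤ} {x : ℤ} (hx : Even ((n : ℤ) + x))
    (hA : ∀ y : ℤ, |y - x * laneWidth k| ≤ laneWidth k → Even ((levelTime c k n : ℤ) + y) → y ∈ A) :
    Alive c k n A x := by
  induction k generalizing n x with
  | zero => exact hA x (by simp [laneWidth]) hx
  | succ k ih =>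
    right
    intro y h1 h2 h3
    refine ih h3 fun z hz hz' ↦ hA z ?_ hz'
    have hW : (10 : ℤ) ≤ width k := by exact_mod_cast ten_le_width k
    have hw : (0 : ℤ) ≤ laneWidth k := Int.natCast_nonneg _
    simp only [laneWidth]
    push_cast
    have h4 : |(y - x * width k) * laneWidth k| ≤ 6 * laneWidth k := by
      rw [abs_mul, abs_of_nonneg hw]
      exact mul_le_mul_of_nonneg_right (abs_le.2 ⟨by omega, by omega⟩) hw
    calc |z - x * (width k * laneWidth k)|
        = |(z - y * laneWidth k) + (y - x * width k) * laneWidth k| := by ring_nf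
      _ ≤ |z - y * laneWidth k| + |(y - x * width k) * laneWidth k| := abs_add_le _ _
      _ ≤ 10 * laneWidth k := by linarith
      _ ≤ _ := mul_le_mul_of_nonneg_right hW hw

end Alive

section Events

variable {Ω : Type*} {mΩ : MeasurableSpace Ω} {μ : Measure Ω} {E : ℕ × ℤ → Set Ω}
  {v c : ℕ → ℕ → ℕ}

/-- The events that the sites of level `k` are open. -/
noncomputable def levelEvent (E : ℕ × ℤ → Set Ω) (c : ℕ → ℕ → ℕ) : ℕ → ℕ × ℤ → Set Ω
  | 0, p => E p
  | k + 1, p => blockEvent (levelEvent E c k) (width k) p.2 (c k p.1) (c k (p.1 + 1))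

/-- The set `B` of the reached space-time points is transmitted by the open sites. -/
def TransmitsFrom (ω : Ω) (E : ℕ × ℤ → Set Ω) (B : ℕ → Set ℤ) : Prop :=
  ∀ (n : ℕ) (y : ℤ), Even ((n : ℤ) + y) → y ∈ B n → ω ∈ E (n, y) → y + 1 ∈ B (n + 1) ∧ y - 1 ∈ B (n + 1)

/-- By induction the alive lanes of level `k` form a transmitted set. This set can be inserted in
the definition of an open block, which quantifies over all such sets. -/
lemma TransmitsFrom.alive {ω : Ω} {B : ℕ → Set ℤ} (hB : TransmitsFrom ω E B) (k : ℕ) {n : ℕ} {x : ℤ}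
    (hx : Even ((n : ℤ) + x)) (hn : Alive c k n (B (levelTime c k n)) x)
    (hω : ω ∈ levelEvent E c k (n, x)) :
    Alive c k (n + 1) (B (levelTime c k (n + 1))) (x + 1) ∧
      Alive c k (n + 1) (B (levelTime c k (n + 1))) (x - 1) := by
  induction k generalizing n x with
  | zero => exact hB n x hx hn hω
  | succ k ih =>
    have := hω (fun n ↦ Alive c k n (B (levelTime c k n)))
      (fun m y _ _ _ _ hy hS hη ↦ ih hy hS hη) hn
    exact ⟨Or.inl this.1, Or.inr this.2⟩

/-- The link between levels at the origin: lane `0` of level `k` spreads through the first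
`runLength k` columns and fills the windows around the centre exactly when level `k + 1` starts. -/
lemma TransmitsFrom.alive_succ {ω : Ω} {B : ℕ → Set ℤ} (hB : TransmitsFrom ω E B) {k : ℕ}
    (hc : c k 0 = runLength k) (h : Alive c k 0 (B (levelTime c k 0)) 0)
    (hω : ω ∈ ⋂ s ∈ regionSites (width k) 0 0 (0 + runLength k), levelEvent E c k s.1) :
    Alive c (k + 1) 0 (B (levelTime c (k + 1) 0)) 0 := by
  have hW := ten_le_width k
  have hR := two_mul_width_add_four_le k
  simp only [Set.mem_iInter] at hω
  have hS : Transmits (fun p ↦ ω ∈ levelEvent E c k p) (width k) 0 0 (runLength k)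
      (fun n ↦ Alive c k n (B (levelTime c k n))) :=
    fun m y _ _ _ _ hy hS hη ↦ hB.alive k hy hS hη
  have := hS.spread_fill (n := 0) (α := 0) (β := 0) le_rfl (by omega) (by omega)
    (Or.inr ⟨rfl, by simp⟩) (by omega) (runLength k) (by omega) (by omega)
    (fun i y h1 h2 h3 h4 h5 ↦ hω ⟨(i, y), h5⟩ (mem_regionSites.2 ⟨⟨h1, h2⟩, h3, h4⟩)) ?_
  · right
    rw [zero_add] at this
    rw [hc, levelTime, hc]
    exact this.mono (by omega) (by omega)
  · intro y h1 h2 _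
    obtain rfl : y = 0 := by omega
    exact h

lemma measurableSet_levelEvent (hE : ∀ p, MeasurableSet (E p)) (k : ℕ) (p : ℕ × ℤ) :
    MeasurableSet (levelEvent E c k p) := by
  induction k generalizing p with
  | zero => exact hE p
  | succ k ih => exact measurableSet_blockEvent ih _ _ _ _

/-- Sites of high level ignore the points before their starting time, which gives the independence
from the initial cone. -/
lemma measurableSet_levelEvent_generateFrom
    (hr : ∀ k, Renormalizes (runLength k) (gain k) (v k) (c k) (v (k + 1))) (k : ℕ) (s : Site) :
    MeasurableSet[⨆ i ∈ {i : Site | levelTime c k s.1.1 ≤ i.1.1}, generateFrom {E i.1}]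
      (levelEvent E c k s.1) := by
  induction k generalizing s with
  | zero =>
    have hle : generateFrom {E s.1} ≤ ⨆ i ∈ {i : Site | levelTime c 0 s.1.1 ≤ i.1.1},
        generateFrom {E i.1} :=
      le_iSup₂_of_le (f := fun (i : Site) _ ↦ generateFrom {E i.1}) s (le_refl s.1.1) le_rfl
    exact hle _ (measurableSet_generateFrom rfl)
  | succ k ih =>
    refine (iSup₂_le fun i hi ↦ generateFrom_le fun t ht ↦ ?_ :
      (⨆ i ∈ (regionSites (width k) s.1.2 (c k s.1.1) (c k (s.1.1 + 1)) : Set Site),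
        generateFrom {levelEvent E c k i.1}) ≤ _) _
      (measurableSet_blockEvent_generateFrom (levelEvent E c k) (width k) s.1.2 (c k s.1.1)
        (c k (s.1.1 + 1)))
    rw [Set.mem_singleton_iff.1 ht]
    refine (biSup_mono fun j hj ↦ ?_ :
      (⨆ j ∈ {j : Site | levelTime c k i.1.1 ≤ j.1.1}, generateFrom {E j.1}) ≤ _) _ (ih i)
    exact (levelTime_mono hr k (mem_regionSites.1 hi).1.1).trans hj

lemma iIndepSet_levelEvent (hE : ∀ p, MeasurableSet (E p))
    (h : iIndepSet (fun s : Site ↦ E s.1) μ)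
    (hr : ∀ k, Renormalizes (runLength k) (gain k) (v k) (c k) (v (k + 1))) (k : ℕ) :
    iIndepSet (fun s : Site ↦ levelEvent E c k s.1) μ := by
  induction k with
  | zero => exact h
  | succ k ih =>
    exact iIndepSet_blockEvent (measurableSet_levelEvent hE k) ih
      (by have := ten_le_width k; omega) (hr k).monotone

variable [IsProbabilityMeasure μ]

lemma siteBound_le_levelEvent (hE : ∀ p, MeasurableSet (E p))
    (h : iIndepSet (fun s : Site ↦ E s.1) μ)
    (hv : ∀ s : Site, siteBound (failBound 0) (v 0 s.1.1) ≤ μ.real (E s.1))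
    (hr : ∀ k, Renormalizes (runLength k) (gain k) (v k) (c k) (v (k + 1))) (k : ℕ) (s : Site) :
    siteBound (failBound k) (v k s.1.1) ≤ μ.real (levelEvent E c k s.1) := by
  induction k generalizing s with
  | zero => exact hv s
  | succ k ih =>
    exact siteBound_le_blockEvent (measurableSet_levelEvent hE k) (iIndepSet_levelEvent hE h hr k)
      ih (hr k) s.1.1 s.1.2

lemma measure_compl_initial_le (hE : ∀ p, MeasurableSet (E p))
    (h : iIndepSet (fun s : Site ↦ E s.1) μ)
    (hv : ∀ s : Site, siteBound (failBound 0) (v 0 s.1.1) ≤ μ.real (E s.1))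
    (hr : ∀ k, Renormalizes (runLength k) (gain k) (v k) (c k) (v (k + 1))) {k : ℕ}
    (hk : ∀ n < runLength k, v k n = 0) :
    μ (⋂ s ∈ regionSites (width k) 0 0 (0 + runLength k), levelEvent E c k s.1)ᶜ ≤
      2⁻¹ ^ (2 + k) := by
  have hm : MeasurableSet
      (⋂ s ∈ regionSites (width k) 0 0 (0 + runLength k), levelEvent E c k s.1) :=
    Finset.measurableSet_biInter _ fun s _ ↦ measurableSet_levelEvent hE k s.1
  have h1 := measureReal_biInter_ge (μ := μ) (E := fun s : Site ↦ levelEvent E c k s.1)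
    (fun s ↦ measurableSet_levelEvent hE k s.1)
    (regionSites (width k) 0 0 (0 + runLength k)) (ε := failBound k) fun s hs ↦ by
      have := siteBound_le_levelEvent hE h hv hr k s
      rwa [hk _ (by have := (mem_regionSites.1 hs).1.2; omega), siteBound, if_pos rfl] at this
  have h2 : ((regionSites (width k) 0 0 (0 + runLength k)).card : ℝ) * failBound k ≤
      (1 / 2) ^ (97 + 6 * k) := by
    rw [← two_mul_runLength_mul_width]
    have : ((regionSites (width k) 0 0 (0 + runLength k)).card : ℝ) ≤
        2 * runLength k * width k := by exact_mod_cast card_regionSites_le (width k) 0 0 (runLength k)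
    exact mul_le_mul_of_nonneg_right this (failBound_nonneg k)
  have h3 : (1 / 2 : ℝ) ^ (97 + 6 * k) ≤ (1 / 2) ^ (2 + k) :=
    pow_le_pow_of_le_one (by norm_num) (by norm_num) (by omega)
  have h4 : μ.real (⋂ s ∈ regionSites (width k) 0 0 (0 + runLength k), levelEvent E c k s.1)ᶜ ≤
      (1 / 2) ^ (2 + k) := by
    rw [measureReal_compl hm, probReal_univ]
    linarith
  rw [← ENNReal.toReal_le_toReal (measure_ne_top _ _) (by simp)]
  simpa [measureReal_def] using h4

/-- The cone of the sites that can be reached from the origin before the time `τ`. -/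
noncomputable def coneSites (τ : ℕ) : Finset Site :=
  (Finset.range τ ×ˢ Finset.Icc (-(τ : ℤ)) τ).subtype _

/-- Every point of the cone has a parent in the cone: step back towards the axis, or to lane `1`
from the axis itself, where parity makes the earlier time positive. -/
lemma TransmitsFrom.mem_of_cone {ω : Ω} {B : ℕ → Set ℤ} (hB : TransmitsFrom ω E B) (h0 : 0 ∈ B 0)
    {τ : ℕ} (hω : ω ∈ ⋂ s ∈ coneSites τ, E s.1) {n : ℕ} (hn : n ≤ τ) {y : ℤ} (hy : |y| ≤ n)
    (hpar : Even ((n : ℤ) + y)) : y ∈ B n := by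
  simp only [Set.mem_iInter] at hω
  have hopen : ∀ (n : ℕ) (y : ℤ), n < τ → |y| ≤ n → Even ((n : ℤ) + y) → ω ∈ E (n, y) := by
    intro n y h1 h2 h3
    rw [abs_le] at h2
    refine hω ⟨(n, y), h3⟩ ?_
    simp only [coneSites, Finset.mem_subtype, Finset.mem_product, Finset.mem_range, Finset.mem_Icc]
    omega
  induction n generalizing y with
  | zero =>
    obtain rfl : y = 0 := by simpa using hy
    exact h0
  | succ n ih =>
    rw [abs_le] at hy
    push_cast at hy hpar
    rw [Int.even_iff] at hpar
    by_cases hpos : 0 < y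
    · have h1 : |y - 1| ≤ (n : ℤ) := abs_le.2 ⟨by omega, by omega⟩
      have h2 : Even ((n : ℤ) + (y - 1)) := by rw [Int.even_iff]; omega
      simpa using (hB n (y - 1) h2 (ih (by omega) h1 h2) (hopen _ _ (by omega) h1 h2)).1
    · have h1 : |y + 1| ≤ (n : ℤ) := abs_le.2 ⟨by omega, by omega⟩
      have h2 : Even ((n : ℤ) + (y + 1)) := by rw [Int.even_iff]; omega
      simpa using (hB n (y + 1) h2 (ih (by omega) h1 h2) (hopen _ _ (by omega) h1 h2)).2

/-- In an environment that is renormalizable at all levels, the transmitted sets that contain the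
origin survive with positive probability. -/
lemma exists_survival_event (hE : ∀ p, MeasurableSet (E p))
    (h : iIndepSet (fun s : Site ↦ E s.1) μ)
    (hv : ∀ s : Site, siteBound (failBound 0) (v 0 s.1.1) ≤ μ.real (E s.1))
    (hr : ∀ k, Renormalizes (runLength k) (gain k) (v k) (c k) (v (k + 1)))
    (hgood : ∀ᶠ k in Filter.atTop, ∀ n < 2 * runLength k, v k n = 0) :
    ∃ G : Set Ω, 0 < μ G ∧ ∀ ω ∈ G, ∀ B : ℕ → Set ℤ, 0 ∈ B 0 → TransmitsFrom ω E B →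
      ∀ m, ∃ n ≥ m, (B n).Nonempty := by
  obtain ⟨k₁, hk₁⟩ := Filter.eventually_atTop.1 hgood
  -- Starting one level later gives `laneWidth k₀ ≤ τ`, so that the open cone at time `τ` covers the
  -- lane `0` of level `k₀`.
  set k₀ := k₁ + 1 with hk₀
  set τ := levelTime c k₀ 0 with hτ
  set D : Set Ω := ⋂ s ∈ coneSites τ, E s.1 with hD
  set F : ℕ → Set Ω := fun k ↦
    ⋂ s ∈ regionSites (width k) 0 0 (0 + runLength k), levelEvent E c k s.1 with hF
  set G : Set Ω := ⋂ k, F (k + k₀) with hG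
  have hle : ∀ s : Site, generateFrom {E s.1} ≤ mΩ := fun s ↦
    generateFrom_le fun t ht ↦ by rw [Set.mem_singleton_iff.1 ht]; exact hE s.1
  have hind : Indep (⨆ s ∈ {s : Site | s.1.1 < τ}, generateFrom {E s.1})
      (⨆ s ∈ {s : Site | τ ≤ s.1.1}, generateFrom {E s.1}) μ := by
    refine indep_iSup_of_disjoint hle ((iIndepSet_iff_iIndep _ _).1 h) ?_
    rw [Set.disjoint_left]
    intro s h1 h2
    exact Nat.not_le.2 (show s.1.1 < τ from h1) h2
  have hDm : MeasurableSet[⨆ s ∈ {s : Site | s.1.1 < τ}, generateFrom {E s.1}] D := by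
    refine (biSup_mono fun s hs ↦ ?_ : (⨆ s ∈ (coneSites τ : Set Site), generateFrom {E s.1}) ≤ _) _
      (measurableSet_biInter_generateFrom (fun s : Site ↦ E s.1) (coneSites τ))
    have hs' : s ∈ coneSites τ := hs
    simp only [coneSites, Finset.mem_subtype, Finset.mem_product, Finset.mem_range] at hs'
    exact hs'.1
  have hGm : MeasurableSet[⨆ s ∈ {s : Site | τ ≤ s.1.1}, generateFrom {E s.1}] G := by
    refine MeasurableSet.iInter fun k ↦ Finset.measurableSet_biInter _ fun s _ ↦ ?_
    refine (biSup_mono fun i hi ↦ ?_ :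
      (⨆ i ∈ {i : Site | levelTime c (k + k₀) s.1.1 ≤ i.1.1}, generateFrom {E i.1}) ≤ _) _
      (measurableSet_levelEvent_generateFrom hr (k + k₀) s)
    have h1 : Monotone fun k ↦ levelTime c k 0 := monotone_nat_of_le_succ fun k ↦ by
      have := laneWidth_le_levelTime hr k; omega
    exact (h1 (Nat.le_add_left k₀ k)).trans
      ((levelTime_mono hr (k + k₀) (Nat.zero_le s.1.1)).trans hi)
  refine ⟨D ∩ G, ?_, ?_⟩
  · rw [(Indep_iff _ _ _).1 hind _ _ hDm hGm]
    refine ENNReal.mul_pos ?_ ?_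
    · rw [hD, h.meas_biInter]
      refine Finset.prod_ne_zero_iff.2 fun s _ ↦ ?_
      have h1 := hv s
      have h2 : 0 < siteBound (failBound 0) (v 0 s.1.1) := by
        unfold siteBound
        split_ifs
        · rw [failBound]; norm_num
        · positivity
      intro h3
      rw [measureReal_def, h3] at h1
      simp at h1
      linarith
    · intro h0
      -- The failure probabilities of the levels sum to at most `∑ 2 ^ (-(2 + k)) = 1 / 2`.
      have hc : μ Gᶜ ≤ 2⁻¹ := by
        rw [hG, Set.compl_iInter]
        calc μ (⋃ k, (F (k + k₀))ᶜ) ≤ ∑' k, μ (F (k + k₀))ᶜ := measure_iUnion_le _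
          _ ≤ ∑' k : ℕ, 2⁻¹ ^ (2 + k) := ENNReal.tsum_le_tsum fun k ↦
              (measure_compl_initial_le hE h hv hr fun n hn ↦
                hk₁ (k + k₀) (by omega) n (by omega)).trans
              (pow_le_pow_of_le_one zero_le (ENNReal.inv_le_one.2 (by norm_num)) (by omega))
          _ = 2⁻¹ := by
              simp_rw [pow_add]
              rw [ENNReal.tsum_mul_left, ENNReal.tsum_geometric, ENNReal.one_sub_inv_two, inv_inv,
                pow_two, mul_assoc, ENNReal.inv_mul_cancel (by norm_num) (by norm_num), mul_one]
      have hGm' : MeasurableSet G := MeasurableSet.iInter fun k ↦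
        Finset.measurableSet_biInter _ fun s _ ↦ measurableSet_levelEvent hE _ s.1
      rw [prob_compl_eq_one_sub hGm', h0, tsub_zero] at hc
      exact absurd hc (not_le.2 (ENNReal.inv_lt_one.2 (by norm_num)))
  · rintro ω ⟨hωD, hωG⟩ B h0 hB m
    have hstart : Alive c k₀ 0 (B τ) 0 := by
      refine alive_of_cover (by simp) fun y hy hpar ↦ ?_
      refine hB.mem_of_cone h0 hωD le_rfl ?_ hpar
      have h1 := laneWidth_le_levelTime hr k₁
      have h2 : (laneWidth k₀ : ℤ) ≤ τ := by
        rw [hτ, hk₀]; exact_mod_cast (by omega)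
      simp only [zero_mul, sub_zero] at hy
      exact hy.trans h2
    have halive : ∀ k, Alive c (k + k₀) 0 (B (levelTime c (k + k₀) 0)) 0 := by
      intro k
      induction k with
      | zero => rw [zero_add]; exact hstart
      | succ k ih =>
        rw [Nat.add_right_comm]
        exact hB.alive_succ ((hr (k + k₀)).first_good (hk₁ (k + k₀) (by omega))) ih
          (Set.mem_iInter.1 hωG k)
    exact ⟨_, le_trans (by omega) (le_levelTime hr (m + k₀)), (halive m).nonempty⟩

end Events

end OrientedPercolation

/-! ### The geometric environment, the bond model and the conclusion -/

namespace OrientedPercolation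

open MeasureTheory ProbabilityTheory MeasurableSpace
open scoped ENNReal

section Moment

lemma lintegral_costWeight_geometricMeasure_le {ρ : unitInterval}
    (hρ : (ρ : ℝ) ≤ (1 / 2) ^ 46) :
    ∫⁻ a, costWeight a ∂geometricMeasure (unitInterval.symm ρ) ≤ momentBound 0 := by
  have hne : unitInterval.symm ρ ≠ 0 := by
    intro h
    have := congrArg Subtype.val h
    rw [unitInterval.coe_symm_eq, Set.Icc.coe_zero] at this
    norm_num at hρ
    linarith
  have hterm : ∀ n : ℕ, ENNReal.ofReal
      ((1 - (unitInterval.symm ρ : ℝ)) ^ n * (unitInterval.symm ρ : ℝ)) * costWeight n ≤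
      2⁻¹ ^ 41 * 2⁻¹ ^ n := by
    intro n
    by_cases hn : n = 0
    · simp [hn, costWeight]
    · rw [costWeight, if_neg hn, show (16 : ℝ≥0∞) ^ n = ENNReal.ofReal (16 ^ n) by
        rw [ENNReal.ofReal_pow (by norm_num)]; norm_num,
        show (2⁻¹ : ℝ≥0∞) ^ 41 * 2⁻¹ ^ n = ENNReal.ofReal ((1 / 2) ^ (41 + n)) by
        rw [← pow_add, ENNReal.ofReal_pow (by norm_num)]
        congr 1
        rw [one_div, ENNReal.ofReal_inv_of_pos (by norm_num)]
        norm_num, ← ENNReal.ofReal_mul (mul_nonneg (pow_nonneg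
          (unitInterval.one_minus_nonneg _) _) (unitInterval.nonneg _))]
      refine ENNReal.ofReal_le_ofReal ?_
      have h1 : (1 - (unitInterval.symm ρ : ℝ)) = ρ := by simp
      rw [h1]
      calc (ρ : ℝ) ^ n * (unitInterval.symm ρ : ℝ) * 16 ^ n ≤ ((1 / 2) ^ 46) ^ n * 1 * 16 ^ n := by
            gcongr
            · exact unitInterval.nonneg _
            · exact unitInterval.nonneg ρ
            · exact unitInterval.le_one _
        _ = (1 / 2) ^ (42 * n) := by
            rw [mul_one, ← mul_pow, pow_mul]
            norm_num
        -- For `n ≥ 1`, `42 * n ≥ 41 + n`.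
        _ ≤ _ := pow_le_pow_of_le_one (by norm_num) (by norm_num) (by omega)
  rw [geometricMeasure_eq hne, lintegral_sum_measure]
  simp_rw [lintegral_smul_measure, lintegral_dirac, smul_eq_mul]
  refine (ENNReal.tsum_le_tsum hterm).trans ?_
  rw [ENNReal.tsum_mul_left, ENNReal.tsum_geometric, ENNReal.one_sub_inv_two, inv_inv, momentBound,
    show 40 + 3 * 0 = 40 by rfl, pow_succ, mul_assoc,
    ENNReal.inv_mul_cancel (by norm_num) (by norm_num), mul_one]

end Moment

section Quenched

variable (ξ : ℤ → ℕ) (p : unitInterval)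

instance : IsProbabilityMeasure (quenchedLaw ξ p) := by
  unfold quenchedLaw; infer_instance

/-- The event that an edge is open. -/
def edgeEvent (e : latticeEdges) : Set Configuration := {ω | ω e = true}

lemma measurableSet_edgeEvent (e : latticeEdges) : MeasurableSet (edgeEvent e) :=
  measurableSet_eq_fun (measurable_pi_apply e) measurable_const

lemma iIndepSet_edgeEvent : iIndepSet edgeEvent (quenchedLaw ξ p) := by
  rw [iIndepSet_iff_meas_biInter measurableSet_edgeEvent]
  intro S
  exact (iIndepFun_infinitePi (P := fun e : latticeEdges ↦
    bernoulliMeasure true false (p ^ (ξ e.1.1.1 + 1))) (X := fun _ ↦ id)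
    fun _ ↦ measurable_id).measure_inter_preimage_eq_mul S
    (sets := fun _ ↦ {true}) fun _ _ ↦ measurableSet_singleton true

lemma measureReal_edgeEvent (e : latticeEdges) :
    (quenchedLaw ξ p).real (edgeEvent e) = p ^ (ξ e.1.1.1 + 1) := by
  have h := (measurePreserving_eval_infinitePi (fun e : latticeEdges ↦
    bernoulliMeasure true false (p ^ (ξ e.1.1.1 + 1))) e).measureReal_preimage
    (measurableSet_singleton true).nullMeasurableSet
  rw [bernoulliMeasure_real_apply_of_mem_of_notMem _
    (measurableSet_singleton true) rfl (by simp)] at h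
  exact h

/-- The event that both edges that leave the point `q` are open. -/
def siteEvent (q : ℕ × ℤ) : Set Configuration :=
  {ω | OpenEdge ω (q.1, q.2) (q.1 + 1, q.2 + 1) ∧ OpenEdge ω (q.1, q.2) (q.1 + 1, q.2 - 1)}

lemma measurableSet_openEdge (v w : ℤ × ℤ) : MeasurableSet {ω | OpenEdge ω v w} := by
  by_cases h : (v, w) ∈ latticeEdges
  · have : {ω | OpenEdge ω v w} = edgeEvent ⟨(v, w), h⟩ := by
      ext ω; exact ⟨fun h' ↦ h'.2, fun h' ↦ ⟨h, h'⟩⟩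
    rw [this]
    exact measurableSet_edgeEvent _
  · simp [OpenEdge, h]

lemma measurableSet_siteEvent (q : ℕ × ℤ) : MeasurableSet (siteEvent q) :=
  (measurableSet_openEdge _ _).inter (measurableSet_openEdge _ _)

/-- The upper edge that leaves a site. -/
def upperEdge (s : Site) : latticeEdges :=
  ⟨((s.1.1, s.1.2), (s.1.1 + 1, s.1.2 + 1)), s.2, by
    have := s.2
    simp only [latticeVertices, Set.mem_ofPred_eq]
    rw [Int.even_iff] at *; omega, rfl, by simp⟩

/-- The lower edge that leaves a site. -/
def lowerEdge (s : Site) : latticeEdges :=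
  ⟨((s.1.1, s.1.2), (s.1.1 + 1, s.1.2 - 1)), s.2, by
    have := s.2
    simp only [latticeVertices, Set.mem_ofPred_eq]
    rw [Int.even_iff] at *; omega, rfl, by simp⟩

lemma upperEdge_ne_lowerEdge (s : Site) : upperEdge s ≠ lowerEdge s := by
  intro h
  have := congrArg (fun e : latticeEdges ↦ e.1.2.2) h
  simp only [upperEdge, lowerEdge] at this
  omega

lemma siteEvent_eq (s : Site) :
    siteEvent s.1 = ⋂ e ∈ ({upperEdge s, lowerEdge s} : Finset latticeEdges), edgeEvent e := by
  ext ω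
  rw [Finset.set_biInter_insert, Finset.set_biInter_singleton]
  constructor
  · rintro ⟨⟨_, h1⟩, ⟨_, h2⟩⟩
    exact ⟨h1, h2⟩
  · rintro ⟨h1, h2⟩
    exact ⟨⟨(upperEdge s).2, h1⟩, ⟨(lowerEdge s).2, h2⟩⟩

/-- An edge determines the point it leaves, so distinct points use disjoint pairs of edges. -/
lemma iIndepSet_siteEvent : iIndepSet (fun s : Site ↦ siteEvent s.1) (quenchedLaw ξ p) := by
  refine iIndepSet_of_disjoint measurableSet_edgeEvent (iIndepSet_edgeEvent ξ p)
    (S := fun s ↦ (({upperEdge s, lowerEdge s} : Finset latticeEdges) : Set latticeEdges)) ?_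
    fun s ↦ ?_
  · intro s s' hne
    rw [Finset.disjoint_coe, Finset.disjoint_left]
    intro e h1 h2
    have h : ∀ s : Site, e ∈ ({upperEdge s, lowerEdge s} : Finset latticeEdges) →
        e.1.1 = ((s.1.1 : ℤ), s.1.2) := by
      intro s hs
      rw [Finset.mem_insert, Finset.mem_singleton] at hs
      rcases hs with rfl | rfl <;> rfl
    have h3 := (h s h1).symm.trans (h s' h2)
    simp only [Prod.mk.injEq, Nat.cast_inj] at h3
    exact hne (Subtype.ext (Prod.ext h3.1 h3.2))
  · rw [siteEvent_eq]
    exact measurableSet_biInter_generateFrom edgeEvent _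

lemma measureReal_siteEvent (s : Site) :
    (quenchedLaw ξ p).real (siteEvent s.1) = ((p : ℝ) ^ (ξ s.1.1 + 1)) ^ 2 := by
  rw [siteEvent_eq, measureReal_def, (iIndepSet_edgeEvent ξ p).meas_biInter,
    Finset.prod_pair (upperEdge_ne_lowerEdge s), ENNReal.toReal_mul, ← measureReal_def,
    ← measureReal_def, measureReal_edgeEvent, measureReal_edgeEvent, pow_two]
  rfl

/-- A point is open with probability `p ^ (2 * (l + 1))`. For `l ≥ 1` this is at least `(p ^ 4) ^
l`, and `p ^ 4 ≥ 1 / 2`; for `l = 0`, compare squares. -/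
lemma siteBound_le_pow {p : unitInterval} (hp : 1 - (1 / 2 : ℝ) ^ 190 ≤ (p : ℝ) ^ 4) (l : ℕ) :
    siteBound (failBound 0) l ≤ ((p : ℝ) ^ (l + 1)) ^ 2 := by
  have hp0 : 0 ≤ (p : ℝ) := unitInterval.nonneg p
  unfold siteBound
  split_ifs with hl
  · rw [hl, zero_add, pow_one, failBound]
    refine le_of_sq_le_sq ?_ (by positivity)
    rw [← pow_mul]
    refine le_trans ?_ hp
    norm_num
  · rw [← pow_mul]
    calc (1 / 2 : ℝ) ^ l ≤ ((p : ℝ) ^ 4) ^ l := by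
          gcongr
          refine le_trans ?_ hp
          norm_num
      _ = (p : ℝ) ^ (4 * l) := by rw [pow_mul]
      _ ≤ _ := pow_le_pow_of_le_one hp0 (unitInterval.le_one p) (by omega)

lemma transmitsFrom_openCluster (ω : Configuration) :
    TransmitsFrom ω siteEvent fun n ↦ {y : ℤ | ((n : ℤ), y) ∈ openCluster ω (0, 0)} := by
  intro n y _ hy hω
  simp only [Set.mem_ofPred_eq, Nat.cast_add, Nat.cast_one]
  exact ⟨Relation.ReflTransGen.tail hy hω.1, Relation.ReflTransGen.tail hy hω.2⟩

lemma infinite_of_forall_exists_nonempty {C : Set (ℤ × ℤ)}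
    (h : ∀ m : ℕ, ∃ n ≥ m, {y : ℤ | ((n : ℤ), y) ∈ C}.Nonempty) : C.Infinite := by
  refine Set.Infinite.of_image (fun q : ℤ × ℤ ↦ q.1.toNat) ?_
  refine Set.infinite_of_forall_exists_gt fun m ↦ ?_
  obtain ⟨n, hn, y, hy⟩ := h (m + 1)
  exact ⟨n, ⟨_, hy, by simp⟩, by omega⟩

/-- In an environment that is renormalizable at all levels, the origin is connected to infinity
with positive probability. -/
lemma quenchedLaw_connectedToInfinity_pos {ξ : ℤ → ℕ} {p : unitInterval}
    (hp : 1 - (1 / 2 : ℝ) ^ 190 ≤ (p : ℝ) ^ 4) {v c : ℕ → ℕ → ℕ} (hξ : ∀ n : ℕ, v 0 n = ξ n)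
    (hr : ∀ k, Renormalizes (runLength k) (gain k) (v k) (c k) (v (k + 1)))
    (hgood : ∀ᶠ k in Filter.atTop, ∀ n < 2 * runLength k, v k n = 0) :
    0 < quenchedLaw ξ p (connectedToInfinity (0, 0)) := by
  obtain ⟨G, hG, hsurv⟩ := exists_survival_event (μ := quenchedLaw ξ p) (E := siteEvent)
    measurableSet_siteEvent (iIndepSet_siteEvent ξ p)
    (fun s ↦ by rw [measureReal_siteEvent, hξ]; exact siteBound_le_pow hp _) hr hgood
  refine hG.trans_le (measure_mono fun ω hω ↦ ?_)
  exact infinite_of_forall_exists_nonempty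
    (hsurv ω hω _ Relation.ReflTransGen.refl (transmitsFrom_openCluster ω))

end Quenched

/-- Oriented paths from the origin only meet the columns of nonnegative index. -/
lemma hasLaw_streamLaw {Ω : Type*} [MeasurableSpace Ω] {μ : Measure Ω} {P : Measure ℕ}
    {ξ : ℤ → Ω → ℕ} (hind : iIndepFun ξ μ) (hlaw : ∀ i, HasLaw (ξ i) P μ) :
    HasLaw (fun a (n : ℕ) ↦ ξ n a) (streamLaw P) μ :=
  (hind.precomp (g := ((↑) : ℕ → ℤ)) Nat.cast_injective).hasLaw_infinitePi (fun n ↦ hlaw n)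
    (aemeasurable_pi_lambda _ fun n ↦ (hlaw n).aemeasurable)

end OrientedPercolation

theorem theorem7p2
    {Ω : Type*} [MeasurableSpace Ω] (μ : MeasureTheory.Measure Ω)
    [MeasureTheory.IsProbabilityMeasure μ]
    (L : ℝ) (hL : L = 10 ^ 6)
    (ρ p : unitInterval)
    (hρ : (ρ : ℝ) ≤ L ^ (-16 : ℤ))
    (hp : (1 - L ^ (-10 : ℤ)) ^ (1 / 4 : ℝ) ≤ (p : ℝ))
    (ξ : ℤ → Ω → ℕ)
    (hξ_indep : ProbabilityTheory.iIndepFun ξ μ)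
    (hξ_law : ∀ i, ProbabilityTheory.HasLaw (ξ i)
      (ProbabilityTheory.geometricMeasure (unitInterval.symm ρ)) μ) :
    ∀ᵐ a ∂μ, 0 < OrientedPercolation.quenchedLaw (fun i ↦ ξ i a) p
      (OrientedPercolation.connectedToInfinity (0, 0)) := by
  subst hL
  -- The assumptions leave room: `10 ^ (-96)` is far below `2 ^ (-46)`, and `10 ^ (-60)` is below `2
  -- ^ (-190)`.
  have hρ' : (ρ : ℝ) ≤ (1 / 2) ^ 46 := hρ.trans (by norm_num)
  have hp' : 1 - (1 / 2 : ℝ) ^ 190 ≤ (p : ℝ) ^ 4 := by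
    have h0 : (0 : ℝ) ≤ 1 - (10 ^ 6) ^ (-10 : ℤ) := by norm_num
    have h1 : 1 - ((10 : ℝ) ^ 6) ^ (-10 : ℤ) ≤ (p : ℝ) ^ 4 := by
      calc 1 - ((10 : ℝ) ^ 6) ^ (-10 : ℤ)
          = ((1 - ((10 : ℝ) ^ 6) ^ (-10 : ℤ)) ^ (1 / 4 : ℝ)) ^ 4 := by
            rw [← Real.rpow_mul_natCast h0]; norm_num
        _ ≤ _ := by gcongr
    refine le_trans ?_ h1
    norm_num
  have hlaw := OrientedPercolation.hasLaw_streamLaw hξ_indep hξ_law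
  have h := OrientedPercolation.ae_levels
    (OrientedPercolation.lintegral_costWeight_geometricMeasure_le hρ')
  rw [← hlaw.map_eq] at h
  filter_upwards [MeasureTheory.ae_of_ae_map hlaw.aemeasurable h] with a ha
  exact OrientedPercolation.quenchedLaw_connectedToInfinity_pos hp' (fun _ ↦ rfl) ha.1 ha.2
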